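/- Let $D<-3$ be a squarefree integer, $K=\mathbb{Q}(\sqrt D)\subset\mathbb{C}$ with ring of integers $\mathcal{O}$, and let $n\ge 12$. Let $\Lambda$ be a free $\mathcal{O}$-module of rank $n+1$ with a $K$-valued hermitian form of signature $(n,1)$, extended to $\Lambda_{\mathbb{C}}=\Lambda\otimes_{\mathcal{O}}\mathbb{C}$, let $U(\Lambda)$ be the group of $\mathcal{O}$-linear automorphisms of $\Lambda$ preserving the form, and let $\Gamma\le U(\Lambda)$ be a subgroup of finite index. Let $[\omega]\in\mathbb{P}(\Lambda_{\mathbb{C}})$ be a point on which the form is negative, i.e. $[\omega]\in\mathbb{C}H^n$. Put $\mathbb{W}=\mathbb{C}\omega$, let $G=\{g\in\Gamma: g[\omega]=[\omega]\}$ be the stabiliser of $[\omega]$ in $\Gamma$, and let $V=\operatorname{Hom}(\mathbb{W},\Lambda_{\mathbb{C}}/\mathbb{W})$ be the tangent space of $\mathbb{C}H^n$ at $[\omega]$, an $n$-dimensional complex vector space on which $G$ acts. An element of $G$ is a quasi-reflection on $V$ if its fixed space in $V$ has codimension exactly $1$. Let $g\in G$ be such that some positive power of $g$ is a quasi-reflection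 on $V$, let $k$ be the smallest positive integer for which $h=g^k$ is a quasi-reflection on $V$, and suppose that $k>1$. Let $l$ be the order of $h$ on $V$ and let $\zeta$ be a primitive $lk$-th root of unity. Then the eigenvalues of $g$ on $V$, counted with multiplicity, can be written as $\zeta^{a_1},\dots,\zeta^{a_n}$ with $0\le a_i<lk$, numbered so that $\zeta^{ka_n}\neq 1$ is the eigenvalue of $h$ on $V$ different from $1$. For every such choice of $a_1,\dots,a_n$, the modified Reid–Tai sum satisfies $$\Sigma'(g^f):=\left\{\frac{f a_n}{k}\right\}+\sum_{i=1}^{n-1}\left\{\frac{f a_i}{lk}\right\}\ \ge\ 1\qquad\text{for all integers } 1\le f<k,$$ where $\{q\}$ denotes the fractional part of $q$. -/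

import Mathlib

open scoped TensorProduct NumberField ComplexConjugate LinearAlgebra.Projectivization

noncomputable section

namespace BallQuotient

/-- The imaginary quadratic field `ℚ(√D)`, for `D < 0`, as a subfield of `ℂ`. -/
abbrev QuadField (D : ℤ) : IntermediateField ℚ ℂ :=
  IntermediateField.adjoin ℚ {Complex.I * ((Real.sqrt (-(D : ℝ)) : ℝ) : ℂ)}

/-- The ring of integers of `ℚ(√D)`. -/
abbrev Order (D : ℤ) : Type := 𝓞 (QuadField D)

/-- The complexification `Λ ⊗ ℂ` of an `𝒪`-module `Λ`. -/
abbrev Complexified (D : ℤ) (Λ : Type*) [AddCommGroup Λ] [Module (Order D) Λ] : Type _ :=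
  ℂ ⊗[Order D] Λ

/-- A hermitian form of signature `(n,1)` on an `𝒪`-module `Λ`, given by its sesquilinear
extension to `Λ ⊗ ℂ`.  The condition `rational` says that this extension comes from a form on `Λ`,
with values in `ℚ(√D)`. -/
structure HermitianStructure (D : ℤ) (n : ℕ) (Λ : Type*) [AddCommGroup Λ]
    [Module (Order D) Λ] where
  form : Complexified D Λ →ₗ⋆[ℂ] Complexified D Λ →ₗ[ℂ] ℂ
  hermitian : ∀ x y, conj (form x y) = form y x
  rational : ∀ x y : Λ, form (1 ⊗ₜ[Order D] x) (1 ⊗ₜ[Order D] y) ∈ QuadField D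
  signature : ∃ b : Module.Basis (Fin (n + 1)) ℂ (Complexified D Λ), ∀ i j,
    form (b i) (b j) = if i = j then (if i = Fin.last n then -1 else 1) else 0

section Lattice

variable {D : ℤ} {n : ℕ} {Λ : Type*} [AddCommGroup Λ] [Module (Order D) Λ]

/-- The `ℂ`-linear extension of an automorphism of `Λ`. -/
def complexify (g : Λ ≃ₗ[Order D] Λ) : Complexified D Λ ≃ₗ[ℂ] Complexified D Λ :=
  LinearEquiv.baseChange (Order D) ℂ Λ Λ g

/-- `U(Λ)`: the `𝒪`-linear automorphisms of `Λ` that preserve the hermitian form. -/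
def unitaryGroup (h : HermitianStructure D n Λ) : Subgroup (Λ ≃ₗ[Order D] Λ) where
  carrier := {g | ∀ x y : Λ, h.form (1 ⊗ₜ[Order D] g x) (1 ⊗ₜ[Order D] g y) =
    h.form (1 ⊗ₜ[Order D] x) (1 ⊗ₜ[Order D] y)}
  one_mem' := fun _ _ => rfl
  mul_mem' := fun {a b} ha hb x y => (ha (b x) (b y)).trans (hb x y)
  inv_mem' := fun {a} ha x y => by
    have h1 := ha (a⁻¹ x) (a⁻¹ y)
    have h2 : ∀ z, a (a⁻¹ z) = z := fun z => a.apply_symm_apply z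
    rw [h2, h2] at h1
    exact h1.symm

/-- Complex hyperbolic space: the negative points of `ℙ(Λ ⊗ ℂ)`. -/
def hyperbolicSpace (h : HermitianStructure D n Λ) : Set (ℙ ℂ (Complexified D Λ)) :=
  {p | (h.form p.rep p.rep).re < 0}

/-- The stabiliser `G = Γ_[ω]` of the point `p = [ω]`: the elements of `Γ` that map the line
`𝕎 = ℂω` to itself. -/
def pointStabilizer {h : HermitianStructure D n Λ} (Γ : Subgroup (unitaryGroup h))
    (p : ℙ ℂ (Complexified D Λ)) : Subgroup (unitaryGroup h) where
  carrier := {g | g ∈ Γ ∧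
    p.submodule.map (complexify (g : Λ ≃ₗ[Order D] Λ)).toLinearMap = p.submodule}
  one_mem' := by
    refine ⟨Γ.one_mem, ?_⟩
    have h1 : (complexify (1 : Λ ≃ₗ[Order D] Λ)).toLinearMap = LinearMap.id :=
      LinearMap.baseChange_id
    simp [h1]
  mul_mem' := by
    rintro a b ⟨ha, ha'⟩ ⟨hb, hb'⟩
    refine ⟨Γ.mul_mem ha hb, ?_⟩
    have h1 : (complexify ((a * b : unitaryGroup h) : Λ ≃ₗ[Order D] Λ)).toLinearMap =
        (complexify (a : Λ ≃ₗ[Order D] Λ)).toLinearMap ∘ₗ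
          (complexify (b : Λ ≃ₗ[Order D] Λ)).toLinearMap :=
      LinearMap.baseChange_comp _ _
    rw [h1, Submodule.map_comp, hb', ha']
  inv_mem' := by
    rintro a ⟨ha, ha'⟩
    refine ⟨Γ.inv_mem ha, ?_⟩
    have h1 : (complexify ((a⁻¹ : unitaryGroup h) : Λ ≃ₗ[Order D] Λ)).toLinearMap ∘ₗ
        (complexify (a : Λ ≃ₗ[Order D] Λ)).toLinearMap = LinearMap.id := by
      refine (LinearMap.baseChange_comp _ _).symm.trans ?_
      have h2 : ((a⁻¹ : unitaryGroup h) : Λ ≃ₗ[Order D] Λ).toLinearMap ∘ₗ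
          (a : Λ ≃ₗ[Order D] Λ).toLinearMap = LinearMap.id := by
        ext x
        exact (a : Λ ≃ₗ[Order D] Λ).symm_apply_apply x
      exact (congrArg _ h2).trans LinearMap.baseChange_id
    conv_lhs => rw [← ha']
    rw [← Submodule.map_comp, h1, Submodule.map_id]

/-- The tangent space `V = Hom(𝕎, (Λ ⊗ ℂ)/𝕎)` at the point `p` with line `𝕎`. -/
abbrev TangentSpace (p : ℙ ℂ (Complexified D Λ)) : Type _ :=
  p.submodule →ₗ[ℂ] (Complexified D Λ ⧸ p.submodule)

/-- The action of an element `g` of the stabiliser on the tangent space: it sends `φ` to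
`ḡ ∘ φ ∘ g⁻¹`, where `ḡ` is the map induced by `g` on `(Λ ⊗ ℂ)/𝕎`. -/
def tangentAction {h : HermitianStructure D n Λ} {Γ : Subgroup (unitaryGroup h)}
    {p : ℙ ℂ (Complexified D Λ)} (g : pointStabilizer Γ p) :
    TangentSpace p ≃ₗ[ℂ] TangentSpace p :=
  LinearEquiv.arrowCongr
    ((complexify ((g : unitaryGroup h) : Λ ≃ₗ[Order D] Λ)).ofSubmodules p.submodule p.submodule
      g.2.2)
    (Submodule.Quotient.equiv p.submodule p.submodule
      (complexify ((g : unitaryGroup h) : Λ ≃ₗ[Order D] Λ)) g.2.2)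

end Lattice

/-- `A` is a quasi-reflection: `A - 1` has rank one, that is, the fixed space of `A` is a
hyperplane. (In a finite group: all eigenvalues but exactly one are `1`.) -/
def IsQuasiReflection {V : Type*} [AddCommGroup V] [Module ℂ V] (A : V ≃ₗ[ℂ] V) : Prop :=
  Module.finrank ℂ (LinearMap.range (A.toLinearMap - LinearMap.id)) = 1

/-- Let `A ^ k` be a quasi-reflection of order `l` and `ζ` a primitive `l * k`-th root of unity.
The predicate says that `ζ ^ a i` (`0 ≤ a i < l * k`) are the eigenvalues of `A`, listed with
multiplicity, and that the index `j` is the one that belongs to the eigenvalue `≠ 1` of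
`A ^ k`. -/
structure IsExponentSystem {V : Type*} [AddCommGroup V] [Module ℂ V] [Module.Finite ℂ V]
    (A : V ≃ₗ[ℂ] V) (l k : ℕ) (ζ : ℂ) {n : ℕ} (a : Fin n → ℕ) (j : Fin n) : Prop where
  lt : ∀ i, a i < l * k
  eigenvalues : A.toLinearMap.charpoly.roots = Finset.univ.val.map (fun i => ζ ^ a i)
  exceptional : (ζ ^ a j) ^ k ≠ 1

/-- The modified Reid–Tai sum
`Σ'(g ^ f) = {f a_j / k} + ∑_{i ≠ j} {f a_i / (l k)}`. -/
def sigmaPrime (l k : ℕ) {n : ℕ} (a : Fin n → ℕ) (j : Fin n) (f : ℕ) : ℚ :=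
  Int.fract (((f * a j : ℕ) : ℚ) / (k : ℚ)) +
    ∑ i ∈ Finset.univ.erase j, Int.fract (((f * a i : ℕ) : ℚ) / ((l * k : ℕ) : ℚ))

end BallQuotient

end

/-! ### Lower bounds for the totient function -/

/-! An element `g` fixing a negative line has finite order: its powers are isometries with bounded
integral matrices. Let `α` be its eigenvalue on the line and `c i` its eigenvalues on the tangent
space; then `α` and the `α * c i` are the roots of a polynomial over `K`. Since `D < -3`, the only
roots of unity in `K` are `±1`. The power `g ^ k` has the eigenvalue `α ^ k` with multiplicity `n`
and one other eigenvalue `(α * c j) ^ k`. Both lie in `K`, so they are `1` and `-1` in some order;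
hence `c j ^ k = -1` and `l = 2`. A `K`-conjugate of `α * c j` has the same `k`-th power, which no
other eigenvalue has, so `α * c j = ±1` (`pow_eigenvalues`, `exceptional_eigenvalue`).

Put `τ = α ^ f` and let the angle of `ζ ^ e` be the fractional part of `e / (2 * k)`. Removing the
exceptional eigenvalue of `g ^ f` leaves `n` roots `z` of a polynomial over `K`, one of them `τ`,
and the modified sum becomes the angle `y` of `τ⁻²` plus the sum of the angles of all `z * τ⁻¹`.

A Galois orbit over `K` of primitive `d`-th roots of unity contains `z` or `z⁻¹` for every such root
`z` (`aeval_eq_zero_or`), so it has at least `φ(d) / 2` elements. Their angles are distinct and lie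
in one arithmetic progression, of step `1 / d` or, for even `d`, `2 / d`. This bounds angle sums
below by totient estimates. Small orders are treated by pairing inverse roots.

If `τ = ±1`, minimality of `k` yields a root other than `±1`, and the angles in its orbit sum to at
least `1` (`one_le_sum_of_root_ne`). If `τ ≠ ±1` and `y ≥ 1/6`, each orbit has sum at least `1` or
average at least `1/12`, and `n ≥ 12` suffices. If `y < 1/6`, each orbit has sum at least `1` or
average at least `y / 2`, and the orbit of `τ` itself supplies the deficit `1 - 7 * y`
(`one_le_sum_of_root`). -/

theorem Nat.pow_three_le_totient_pow_four {q : ℕ} (h2 : ¬ 2 ∣ q) (h3 : ¬ 3 ∣ q) :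
    q ^ 3 ≤ q.totient ^ 4 := by
  induction q using Nat.recOnPosPrimePosCoprime with
  | prime_pow p n hp hn =>
    rw [Nat.totient_prime_pow hp hn]
    obtain ⟨m, rfl⟩ : ∃ m, n = m + 1 := ⟨n - 1, by omega⟩
    have hp5 : 5 ≤ p := by
      have hp2 := hp.two_le
      by_contra hlt
      have : p = 2 ∨ p = 3 ∨ p = 4 := by omega
      rcases this with rfl | rfl | rfl
      · exact h2 (dvd_pow_self 2 (by omega))
      · exact h3 (dvd_pow_self 3 (by omega))
      · revert hp; decide
    obtain ⟨s, rfl⟩ : ∃ s, p = s + 5 := ⟨p - 5, by omega⟩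
    -- This is `p ^ 3 ≤ (p - 1) ^ 4`, which fails for the primes `2` and `3`.
    have key : (s + 5) ^ 3 ≤ (s + 4) ^ 4 := by
      ring_nf
      have : 0 ≤ s ^ 3 := Nat.zero_le _
      nlinarith
    have hA : 1 ≤ (s + 5) ^ m := Nat.one_le_pow _ _ (by omega)
    have e1 : ((s + 5) ^ (m + 1)) ^ 3 = ((s + 5) ^ m) ^ 3 * (s + 5) ^ 3 := by ring
    have e2 : ((s + 5) ^ (m + 1 - 1) * (s + 5 - 1)) ^ 4 = ((s + 5) ^ m) ^ 4 * (s + 4) ^ 4 := by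
      rw [show m + 1 - 1 = m by omega, show s + 5 - 1 = s + 4 by omega]; ring
    rw [e1, e2]
    exact Nat.mul_le_mul (Nat.pow_le_pow_right hA (by norm_num)) key
  | zero => simp at h2
  | one => simp
  | coprime a b ha hb hab iha ihb =>
    rw [Nat.totient_mul hab, mul_pow, mul_pow]
    exact Nat.mul_le_mul
      (iha (fun h => h2 (h.mul_right b)) (fun h => h3 (h.mul_right b)))
      (ihb (fun h => h2 (h.mul_left a)) (fun h => h3 (h.mul_left a)))

/-- The constant `27 / 16 = 3 ^ 3 / 2 ^ 4` is the loss at the prime `3`. -/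
theorem Nat.pow_three_le_totient_pow_four_of_odd {q : ℕ} (h2 : ¬ 2 ∣ q) :
    16 * q ^ 3 ≤ 27 * q.totient ^ 4 := by
  have hq : q ≠ 0 := by rintro rfl; simp at h2
  obtain ⟨n, m, hm, rfl⟩ := Nat.exists_eq_pow_mul_and_not_dvd hq 3 (by norm_num)
  have hm2 : ¬ 2 ∣ m := fun h => h2 (h.mul_left _)
  have key := Nat.pow_three_le_totient_pow_four hm2 hm
  have hcop : Nat.Coprime (3 ^ n) m :=
    Nat.Coprime.pow_left _ ((Nat.Prime.coprime_iff_not_dvd Nat.prime_three).2 hm)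
  rw [Nat.totient_mul hcop]
  rcases Nat.eq_zero_or_pos n with rfl | hn
  · simp; omega
  · rw [Nat.totient_prime_pow Nat.prime_three hn]
    obtain ⟨s, rfl⟩ : ∃ s, n = s + 1 := ⟨n - 1, by omega⟩
    have hA : 1 ≤ 3 ^ s := Nat.one_le_pow _ _ (by omega)
    have hB : (3 ^ s) ^ 3 ≤ (3 ^ s) ^ 4 := Nat.pow_le_pow_right hA (by norm_num)
    have := Nat.mul_le_mul hB key
    rw [show s + 1 - 1 = s by omega]
    calc 16 * (3 ^ (s + 1) * m) ^ 3 = 432 * ((3 ^ s) ^ 3 * m ^ 3) := by ring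
      _ ≤ 432 * ((3 ^ s) ^ 4 * m.totient ^ 4) := by omega
      _ = _ := by norm_num; ring

theorem Nat.two_mul_pow_three_le_totient_pow_four {q : ℕ} (hq : q ≠ 0) :
    2 * q ^ 3 ≤ 27 * q.totient ^ 4 := by
  obtain ⟨n, m, hm, rfl⟩ := Nat.exists_eq_pow_mul_and_not_dvd hq 2 (by norm_num)
  have key := Nat.pow_three_le_totient_pow_four_of_odd hm
  have hcop : Nat.Coprime (2 ^ n) m :=
    Nat.Coprime.pow_left _ ((Nat.Prime.coprime_iff_not_dvd Nat.prime_two).2 hm)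
  rw [Nat.totient_mul hcop]
  rcases Nat.eq_zero_or_pos n with rfl | hn
  · simp; omega
  · rw [Nat.totient_prime_pow Nat.prime_two hn]
    obtain ⟨s, rfl⟩ : ∃ s, n = s + 1 := ⟨n - 1, by omega⟩
    have hA : 1 ≤ 2 ^ s := Nat.one_le_pow _ _ (by omega)
    have hB : (2 ^ s) ^ 3 ≤ (2 ^ s) ^ 4 := Nat.pow_le_pow_right hA (by norm_num)
    have := Nat.mul_le_mul hB key
    rw [show s + 1 - 1 = s by omega]
    calc 2 * (2 ^ (s + 1) * m) ^ 3 = (2 ^ s) ^ 3 * (16 * m ^ 3) := by ring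
      _ ≤ (2 ^ s) ^ 4 * (27 * m.totient ^ 4) := this
      _ = _ := by norm_num; ring

/-- For `m ≥ φ(d) / 2` this gives `m * (m - 1) ≥ 2 * d`: then `m` distinct angles in a progression
of step `1 / d` sum to at least `1`. The growth of the totient settles large `d`, a finite check the
rest. -/
theorem Nat.eight_mul_le_totient_mul_of_odd {d : ℕ} (hd : 21 < d) (h2 : d % 2 = 1) :
    8 * d ≤ d.totient * (d.totient - 2) := by
  rcases lt_or_ge d 250 with h | h
  · have : ∀ d ∈ Finset.range 250, 21 < d → d % 2 = 1 → 8 * d ≤ d.totient * (d.totient - 2) := by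
      decide +kernel
    exact this d (Finset.mem_range.2 h) hd h2
  · have key := Nat.pow_three_le_totient_pow_four_of_odd (q := d) (by omega)
    by_contra hlt
    push Not at hlt
    generalize d.totient = t at *
    have ht : 2 ≤ t := by
      by_contra h'
      have : t ≤ 1 := by omega
      have : t ^ 4 ≤ 1 ^ 4 := Nat.pow_le_pow_left this 4
      have : 250 ^ 3 ≤ d ^ 3 := Nat.pow_le_pow_left h 3
      omega
    obtain ⟨s, rfl⟩ : ∃ s, t = s + 2 := ⟨t - 2, by omega⟩
    rw [show s + 2 - 2 = s by omega] at hlt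
    -- With `t = s + 2`, a failure means `t ^ 2 < 8 * d + 2 * t`; the term `2 * t` is absorbed into
    -- one more `d`. The totient bound then forces `16 * d ≤ 27 * 81`, contradicting `d ≥ 250`.
    have h9 : (s + 2) ^ 2 ≤ 9 * d := by
      by_contra h9
      have : s < d := by nlinarith
      have hs : s * s < 8 * d := by nlinarith
      have : 2 * s + 4 > d := by nlinarith
      nlinarith
    have h4 : (s + 2) ^ 4 ≤ 81 * d ^ 2 := by
      calc (s + 2) ^ 4 = ((s + 2) ^ 2) ^ 2 := by ring
        _ ≤ (9 * d) ^ 2 := Nat.pow_le_pow_left h9 2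
        _ = _ := by ring
    have : 16 * d * d ^ 2 ≤ 2187 * d ^ 2 := by nlinarith
    have := Nat.le_of_mul_le_mul_right this (by positivity)
    omega

/-- For even `d` the progression has step `2 / d`, so half the bound of the odd case is enough. -/
theorem Nat.four_mul_le_totient_mul {d : ℕ} (hd : 60 < d) :
    4 * d ≤ d.totient * (d.totient - 2) := by
  rcases lt_or_ge d 350 with h | h
  · have : ∀ d ∈ Finset.range 350, 60 < d → 4 * d ≤ d.totient * (d.totient - 2) := by
      decide +kernel
    exact this d (Finset.mem_range.2 h) hd
  · have key := Nat.two_mul_pow_three_le_totient_pow_four (q := d) (by omega)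
    by_contra hlt
    push Not at hlt
    generalize d.totient = t at *
    have ht : 2 ≤ t := by
      by_contra h'
      have : t ≤ 1 := by omega
      have : t ^ 4 ≤ 1 ^ 4 := Nat.pow_le_pow_left this 4
      have : 250 ^ 3 ≤ d ^ 3 := Nat.pow_le_pow_left (by omega) 3
      omega
    obtain ⟨s, rfl⟩ : ∃ s, t = s + 2 := ⟨t - 2, by omega⟩
    rw [show s + 2 - 2 = s by omega] at hlt
    have h9 : (s + 2) ^ 2 ≤ 5 * d := by
      by_contra h9
      have hs : s * s < 4 * d := by nlinarith
      have : 2 * s + 4 > d := by nlinarith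
      nlinarith
    have h4 : (s + 2) ^ 4 ≤ 25 * d ^ 2 := by
      calc (s + 2) ^ 4 = ((s + 2) ^ 2) ^ 2 := by ring
        _ ≤ (5 * d) ^ 2 := Nat.pow_le_pow_left h9 2
        _ = _ := by ring
    have : 2 * d * d ^ 2 ≤ 675 * d ^ 2 := by nlinarith
    have := Nat.le_of_mul_le_mul_right this (by positivity)
    omega

/-! ### Numerical inequalities -/

/-- A lower bound for the sum of finitely many distinct nonnegative members of an arithmetic
progression. -/
theorem Finset.card_mul_le_sum_of_injOn {ι : Type*} (s : Finset ι) (x : ι → ℚ) (c δ : ℚ)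
    (hδ : 0 < δ) (hx : ∀ i ∈ s, 0 ≤ x i) (hc : ∀ i ∈ s, ∃ m : ℤ, x i = c + m * δ)
    (hinj : Set.InjOn x s) : (s.card : ℚ) * (s.card - 1) * δ ≤ 2 * ∑ i ∈ s, x i := by
  classical
  choose! m hm using hc
  have hmin : Set.InjOn m s := fun i hi j hj h => hinj hi hj (by rw [hm i hi, hm j hj, h])
  -- The ceiling is the index of the first nonnegative member of the progression; the sum is least
  -- when the indices are consecutive from there.
  have hge : ∀ i ∈ s, ⌈-c / δ⌉ ≤ m i := fun i hi => Int.ceil_le.2 (by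
    rw [div_le_iff₀ hδ]; linarith [hx i hi, hm i hi])
  have hc0 : 0 ≤ c + ⌈-c / δ⌉ * δ := by
    have := Int.le_ceil (-c / δ)
    rw [div_le_iff₀ hδ] at this; linarith
  have h1 := Finset.sum_range_le_sum (s := s.image m) (c := ⌈-c / δ⌉)
    (fun z hz => by obtain ⟨i, hi, rfl⟩ := Finset.mem_image.1 hz; exact hge i hi)
  rw [Finset.sum_image hmin, Finset.card_image_of_injOn hmin, Finset.sum_add_distrib,
    Finset.sum_const, nsmul_eq_mul, Finset.card_range] at h1
  have h2 : ∀ k : ℕ, (2 : ℚ) * ∑ i ∈ Finset.range k, (i : ℚ) = k * (k - 1) := by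
    intro k
    induction k with
    | zero => simp
    | succ k ih => rw [Finset.sum_range_succ, mul_add, ih]; push_cast; ring
  have h3 : ((s.card : ℚ) * ⌈-c / δ⌉ + ∑ i ∈ Finset.range s.card, (i : ℚ)) ≤
      ∑ i ∈ s, (m i : ℚ) := by
    have := (Int.cast_le (R := ℚ)).2 h1
    push_cast at this
    exact this
  have h4 : ∑ i ∈ s, x i = s.card * c + (∑ i ∈ s, (m i : ℚ)) * δ := by
    rw [Finset.sum_congr rfl hm, Finset.sum_add_distrib, Finset.sum_const, nsmul_eq_mul,
      Finset.sum_mul]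
  rw [h4]
  have h5 := mul_le_mul_of_nonneg_right h3 hδ.le
  have h6 := h2 s.card
  have h7 : (0 : ℚ) ≤ s.card * (c + ⌈-c / δ⌉ * δ) := by positivity
  rw [← h6]
  nlinarith

/-- Here `m` is the size of a half system with angle sum `S`, and `m * (m - 1) ≤ 2 * d * S`. The
first alternative yields `S ≥ m / 12`, the second `S ≥ 1`. The even version below plays the same
role with `m * (m - 1) ≤ d * S`. -/
theorem Nat.totient_half_bound_odd {d : ℕ} (hd : 5 ≤ d) (h2 : d % 2 = 1) {m : ℕ}
    (hm : d.totient ≤ 2 * m) : d + 6 ≤ 6 * m ∨ m + 2 * d ≤ m * m := by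
  rcases lt_or_ge d 22 with h | h
  · have : ∀ d ∈ Finset.range 22, 5 ≤ d → d % 2 = 1 → d + 6 ≤ 3 * d.totient := by decide +kernel
    have := this d (Finset.mem_range.2 h) hd h2
    left; omega
  · have := Nat.eight_mul_le_totient_mul_of_odd (d := d) (by omega) h2
    right
    have h3 : d.totient * (d.totient - 2) ≤ 2 * m * (2 * m - 2) :=
      Nat.mul_le_mul hm (by omega)
    rcases m with _ | m
    · omega
    · rw [show 2 * (m + 1) - 2 = 2 * m by omega] at h3
      nlinarith

theorem Nat.totient_half_bound_even {d : ℕ} (hd : 8 ≤ d) (h2 : d % 2 = 0) {m : ℕ}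
    (hm : d.totient ≤ 2 * m) : d + 12 ≤ 12 * m ∨ m + d ≤ m * m := by
  rcases lt_or_ge d 61 with h | h
  · have : ∀ d ∈ Finset.range 61, 8 ≤ d → d % 2 = 0 → d + 12 ≤ 6 * d.totient := by decide +kernel
    have := this d (Finset.mem_range.2 h) hd h2
    left; omega
  · have := Nat.four_mul_le_totient_mul (d := d) (by omega)
    right
    have h3 : d.totient * (d.totient - 2) ≤ 2 * m * (2 * m - 2) :=
      Nat.mul_le_mul hm (by omega)
    rcases m with _ | m
    · omega
    · rw [show 2 * (m + 1) - 2 = 2 * m by omega] at h3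
      nlinarith

/-- When all angles are at least `1 / d`, the progression bound improves to `m * (m + 1) ≤ 2 * d *
S`, so this inequality means `S > 1/2`. The even version below corresponds to `2 * m * m ≤ 2 * d *
S`, and would fail at `d = 18`, `m = 3`. -/
theorem Nat.lt_totient_half_odd {d : ℕ} (hd : 5 ≤ d) (h2 : d % 2 = 1) {m : ℕ}
    (hm : d.totient ≤ 2 * m) : d < m * (m + 1) := by
  rcases lt_or_ge d 22 with h | h
  · have : ∀ d ∈ Finset.range 22, 5 ≤ d → d % 2 = 1 → 4 * d < d.totient * (d.totient + 2) := by
      decide +kernel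
    have := this d (Finset.mem_range.2 h) hd h2
    nlinarith
  · have h1 := Nat.eight_mul_le_totient_mul_of_odd (d := d) (by omega) h2
    have h3 : d.totient * (d.totient - 2) ≤ d.totient * d.totient :=
      Nat.mul_le_mul le_rfl (by omega)
    nlinarith

theorem Nat.lt_totient_half_even {d : ℕ} (hd : 14 ≤ d) (h2 : d % 2 = 0) (h18 : d ≠ 18) {m : ℕ}
    (hm : d.totient ≤ 2 * m) : d < 2 * (m * m) := by
  rcases lt_or_ge d 61 with h | h
  · have : ∀ d ∈ Finset.range 61, 14 ≤ d → d % 2 = 0 → d ≠ 18 → 2 * d < d.totient * d.totient := by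
      decide +kernel
    have := this d (Finset.mem_range.2 h) hd h2 h18
    nlinarith
  · have h1 := Nat.four_mul_le_totient_mul (d := d) (by omega)
    have h3 : d.totient * (d.totient - 2) ≤ d.totient * d.totient :=
      Nat.mul_le_mul le_rfl (by omega)
    nlinarith

/-- This is `relative_sum_of_isHalfSystem` multiplied by `4 * r` for the worst half system: `τ = η ^
a` with `η` a primitive `r`-th root of unity, `2 * (r - a) % r` is the exponent of `τ⁻²`, and each
`u` contributes the smaller of the exponents of `η ^ u * τ⁻¹` and `η ^ (-u) * τ⁻¹`. -/
theorem Nat.sum_min_residue_bound {r : ℕ} (hr : 7 ≤ r) (hr' : r < 70) {a : ℕ} (ha : a < r)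
    (hpos : 0 < 2 * (r - a) % r) (hsmall : 6 * (2 * (r - a) % r) < r)
    (hcop : r.Coprime a) :
    4 * r + r.totient * (2 * (r - a) % r) ≤ 28 * (2 * (r - a) % r) +
      ∑ u ∈ Finset.range r with r.Coprime u,
        2 * min ((u + (r - a)) % r) ((2 * r - u - a) % r) := by
  have : ∀ r ∈ Finset.range 70, 7 ≤ r → ∀ a ∈ Finset.range r,
      0 < 2 * (r - a) % r → 6 * (2 * (r - a) % r) < r → r.Coprime a →
      4 * r + r.totient * (2 * (r - a) % r) ≤ 28 * (2 * (r - a) % r) +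
      ∑ u ∈ Finset.range r with r.Coprime u,
        2 * min ((u + (r - a)) % r) ((2 * r - u - a) % r) := by
    decide +kernel
  exact this r (Finset.mem_range.2 hr') hr a (Finset.mem_range.2 ha) hpos hsmall hcop

/-! ### Angles of roots of unity with respect to a primitive root -/

open scoped Classical in
/-- For a primitive `N`-th root of unity `ζ`, the angle of `ζ ^ e` is the fractional part of
`e / N`. -/
noncomputable def rootAngle (ζ : ℂ) (N : ℕ) (z : ℂ) : ℚ :=
  -- The value `0` off the powers of `ζ` keeps the bounds `0 ≤ rootAngle < 1` free of hypotheses.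
  if h : ∃ e, e < N ∧ ζ ^ e = z then (h.choose : ℚ) / N else 0

namespace IsPrimitiveRoot

variable {ζ : ℂ} {N : ℕ}

theorem rootAngle_pow_of_lt (hζ : IsPrimitiveRoot ζ N) {e : ℕ} (he : e < N) :
    rootAngle ζ N (ζ ^ e) = (e : ℚ) / N := by
  have h : ∃ e', e' < N ∧ ζ ^ e' = ζ ^ e := ⟨e, he, rfl⟩
  rw [rootAngle, dif_pos h, hζ.pow_inj h.choose_spec.1 he h.choose_spec.2]

theorem rootAngle_pow (hζ : IsPrimitiveRoot ζ N) (hN : 0 < N) (e : ℕ) :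
    rootAngle ζ N (ζ ^ e) = Int.fract ((e : ℚ) / N) := by
  have h1 : ζ ^ e = ζ ^ (e % N) := by
    conv_lhs => rw [← Nat.mod_add_div e N, pow_add, pow_mul, hζ.pow_eq_one, one_pow, mul_one]
  rw [h1, hζ.rootAngle_pow_of_lt (Nat.mod_lt _ hN), Int.fract_div_natCast_eq_div_natCast_mod]

theorem rootAngle_nonneg (z : ℂ) : 0 ≤ rootAngle ζ N z := by
  rw [rootAngle]; split_ifs
  · positivity
  · exact le_rfl

theorem rootAngle_lt_one (z : ℂ) : rootAngle ζ N z < 1 := by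
  rw [rootAngle]; split_ifs with h
  · have h1 := h.choose_spec.1
    have h2 : (0 : ℚ) < N := by exact_mod_cast (Nat.zero_le _).trans_lt h1
    rw [div_lt_one h2]; exact_mod_cast h1
  · norm_num

theorem exists_pow_lt (hζ : IsPrimitiveRoot ζ N) (hN : 0 < N) {z : ℂ} (hz : z ^ N = 1) :
    ∃ e, e < N ∧ ζ ^ e = z :=
  haveI : NeZero N := ⟨hN.ne'⟩
  hζ.eq_pow_of_pow_eq_one hz

theorem rootAngle_one (hζ : IsPrimitiveRoot ζ N) (hN : 0 < N) : rootAngle ζ N 1 = 0 := by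
  simpa using hζ.rootAngle_pow_of_lt hN

theorem rootAngle_mul (hζ : IsPrimitiveRoot ζ N) (hN : 0 < N) {z w : ℂ} (hz : z ^ N = 1)
    (hw : w ^ N = 1) :
    ∃ m : ℤ, rootAngle ζ N (z * w) = rootAngle ζ N z + rootAngle ζ N w + m := by
  obtain ⟨a, ha, rfl⟩ := hζ.exists_pow_lt hN hz
  obtain ⟨b, hb, rfl⟩ := hζ.exists_pow_lt hN hw
  refine ⟨-⌊((a + b : ℕ) : ℚ) / N⌋, ?_⟩
  rw [← pow_add, hζ.rootAngle_pow hN, hζ.rootAngle_pow_of_lt ha, hζ.rootAngle_pow_of_lt hb,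
    ← Int.self_sub_floor]
  push_cast
  ring

theorem rootAngle_injOn (hζ : IsPrimitiveRoot ζ N) (hN : 0 < N) {z w : ℂ} (hz : z ^ N = 1)
    (hw : w ^ N = 1) (h : rootAngle ζ N z = rootAngle ζ N w) : z = w := by
  obtain ⟨a, ha, rfl⟩ := hζ.exists_pow_lt hN hz
  obtain ⟨b, hb, rfl⟩ := hζ.exists_pow_lt hN hw
  rw [hζ.rootAngle_pow_of_lt ha, hζ.rootAngle_pow_of_lt hb] at h
  have h2 : (N : ℚ) ≠ 0 := by exact_mod_cast hN.ne'
  have : (a : ℚ) = b := by field_simp at h; exact h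
  rw [Nat.cast_injective this]

theorem rootAngle_pos (hζ : IsPrimitiveRoot ζ N) (hN : 0 < N) {z : ℂ} (hz : z ^ N = 1)
    (h1 : z ≠ 1) : 0 < rootAngle ζ N z := by
  refine lt_of_le_of_ne (rootAngle_nonneg z) fun h => h1 ?_
  exact hζ.rootAngle_injOn hN hz (one_pow N) (by rw [← h, hζ.rootAngle_one hN])

/-- The angle of a `d`-th root of unity is a multiple of `1 / d`. -/
theorem exists_mul_rootAngle_eq (hζ : IsPrimitiveRoot ζ N) (hN : 0 < N) {z : ℂ}
    (hz : z ^ N = 1) {d : ℕ} (hd : z ^ d = 1) : ∃ m : ℤ, d * rootAngle ζ N z = m := by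
  obtain ⟨a, ha, rfl⟩ := hζ.exists_pow_lt hN hz
  rw [← pow_mul, hζ.pow_eq_one_iff_dvd] at hd
  obtain ⟨c, hc⟩ := hd
  refine ⟨c, ?_⟩
  rw [hζ.rootAngle_pow_of_lt ha]
  have h2 : (N : ℚ) ≠ 0 := by exact_mod_cast hN.ne'
  have h3 : (a : ℚ) * d = N * c := by exact_mod_cast hc
  field_simp
  push_cast
  linarith

theorem rootAngle_add_inv (hζ : IsPrimitiveRoot ζ N) (hN : 0 < N) {z : ℂ}
    (hz : z ^ N = 1) (h1 : z ≠ 1) : rootAngle ζ N z + rootAngle ζ N z⁻¹ = 1 := by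
  have hz' : z⁻¹ ^ N = 1 := by rw [inv_pow, hz, inv_one]
  have h0 : z ≠ 0 := by rintro rfl; simp [hN.ne'] at hz
  obtain ⟨m, hm⟩ := hζ.rootAngle_mul hN hz hz'
  rw [mul_inv_cancel₀ h0, hζ.rootAngle_one hN] at hm
  have p1 := hζ.rootAngle_pos hN hz h1
  have p2 := hζ.rootAngle_pos hN hz' (by simpa using h1)
  have q1 := rootAngle_lt_one (ζ := ζ) (N := N) z
  have q2 := rootAngle_lt_one (ζ := ζ) (N := N) z⁻¹
  have l1 : (m : ℚ) < 0 := by linarith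
  have l2 : (-2 : ℚ) < m := by linarith
  have : m = -1 := by
    have a1 : m < 0 := by exact_mod_cast l1
    have a2 : -2 < m := by exact_mod_cast l2
    omega
  rw [this] at hm
  push_cast at hm
  linarith

/-- The angles of `z w` and `z⁻¹ w` add up to at least the angle of `w * w`. -/
theorem rootAngle_sq_le (hζ : IsPrimitiveRoot ζ N) (hN : 0 < N) {z w : ℂ}
    (hz : z ^ N = 1) (hw : w ^ N = 1) :
    rootAngle ζ N (w * w) ≤ rootAngle ζ N (z * w) + rootAngle ζ N (z⁻¹ * w) := by
  have h0 : z ≠ 0 := by rintro rfl; simp [hN.ne'] at hz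
  obtain ⟨m, hm⟩ := hζ.rootAngle_mul hN (z := z * w) (w := z⁻¹ * w)
    (by rw [mul_pow, hz, hw, one_mul]) (by rw [mul_pow, inv_pow, hz, hw, inv_one, one_mul])
  have e : z * w * (z⁻¹ * w) = w * w := by field_simp
  rw [e] at hm
  have h1 := rootAngle_lt_one (ζ := ζ) (N := N) (w * w)
  have h2 := rootAngle_nonneg (ζ := ζ) (N := N) (z * w)
  have h3 := rootAngle_nonneg (ζ := ζ) (N := N) (z⁻¹ * w)
  have : (m : ℚ) < 1 := by linarith
  have : m < 1 := by exact_mod_cast this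
  have : m ≤ 0 := by omega
  have : (m : ℚ) ≤ 0 := by exact_mod_cast this
  linarith

end IsPrimitiveRoot

/-! ### Half systems of primitive roots of unity -/

/-- A set of primitive `d`-th roots of unity that contains `z` or `z⁻¹` for every primitive
`d`-th root of unity `z`. -/
structure IsHalfSystem (d : ℕ) (R : Finset ℂ) : Prop where
  subset : R ⊆ primitiveRoots d ℂ
  mem_or : ∀ z ∈ primitiveRoots d ℂ, z ∈ R ∨ z⁻¹ ∈ R

namespace IsHalfSystem

variable {d : ℕ} {R : Finset ℂ}

theorem inv_mem_primitiveRoots (hd : 0 < d) {z : ℂ} (hz : z ∈ primitiveRoots d ℂ) :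
    z⁻¹ ∈ primitiveRoots d ℂ := by
  rw [mem_primitiveRoots hd] at hz ⊢
  exact hz.inv

/-- If `f z + f z⁻¹ ≥ 0`, then the sum of `f` over a half system is at least half the sum of
`min (f z) (f z⁻¹)` over all primitive roots. -/
theorem sum_min_le (hR : IsHalfSystem d R) (hd : 0 < d) (f : ℂ → ℚ)
    (hf : ∀ z ∈ primitiveRoots d ℂ, 0 ≤ f z + f z⁻¹) :
    ∑ z ∈ primitiveRoots d ℂ, min (f z) (f z⁻¹) ≤ 2 * ∑ z ∈ R, f z := by
  classical
  have e1 : ∑ z ∈ R, f z = ∑ z ∈ primitiveRoots d ℂ, if z ∈ R then f z else 0 := by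
    rw [← Finset.sum_filter, Finset.filter_mem_eq_inter, Finset.inter_eq_right.2 hR.subset]
  -- Inversion permutes the primitive roots, so the sum over `R` can also be indexed by the inverses
  -- of its elements. Adding both forms, every primitive root contributes `f z`, `f z⁻¹` or their
  -- sum, each at least the minimum.
  have e2 : ∑ z ∈ R, f z = ∑ z ∈ primitiveRoots d ℂ, if z⁻¹ ∈ R then f z⁻¹ else 0 := by
    rw [e1]
    exact Finset.sum_bij' (fun z _ => z⁻¹) (fun z _ => z⁻¹)
      (fun z hz => inv_mem_primitiveRoots hd hz) (fun z hz => inv_mem_primitiveRoots hd hz)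
      (by simp) (by simp) (by simp)
  have e3 : 2 * ∑ z ∈ R, f z = ∑ z ∈ primitiveRoots d ℂ,
      ((if z ∈ R then f z else 0) + if z⁻¹ ∈ R then f z⁻¹ else 0) := by
    rw [Finset.sum_add_distrib, ← e1, ← e2]; ring
  rw [e3]
  refine Finset.sum_le_sum fun z hz => ?_
  have h0 := hf z hz
  by_cases h1 : z ∈ R <;> by_cases h2 : z⁻¹ ∈ R
  · rw [if_pos h1, if_pos h2]
    rcases le_total (f z) (f z⁻¹) with h | h
    · rw [min_eq_left h]; linarith
    · rw [min_eq_right h]; linarith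
  · rw [if_pos h1, if_neg h2, add_zero]; exact min_le_left _ _
  · rw [if_neg h1, if_pos h2, zero_add]; exact min_le_right _ _
  · exact ((hR.mem_or z hz).elim h1 h2).elim

theorem totient_le (hR : IsHalfSystem d R) (hd : 0 < d) : d.totient ≤ 2 * R.card := by
  have := hR.sum_min_le hd (fun _ => 1) (fun _ _ => by norm_num)
  simp only [min_self, Finset.sum_const, Complex.card_primitiveRoots, nsmul_eq_mul, mul_one] at this
  exact_mod_cast this

end IsHalfSystem

/-! ### Angle sums over half systems -/

namespace IsPrimitiveRoot

variable {ζ : ℂ} {N : ℕ}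

/-- Lower bound for the sum of the angles of distinct roots of unity with equal `e`-th powers. -/
theorem card_mul_le_sum_rootAngle_of_le (hζ : IsPrimitiveRoot ζ N) (hN : 0 < N) {R : Finset ℂ}
    {e : ℕ} (he : 0 < e) (hRN : ∀ z ∈ R, z ^ N = 1) (hR : ∀ z ∈ R, ∀ w ∈ R, z ^ e = w ^ e)
    {w : ℂ} (hw : w ^ N = 1) {b : ℚ} (hb : ∀ z ∈ R, b ≤ rootAngle ζ N (z * w)) :
    (R.card : ℚ) * (R.card - 1) + 2 * e * b * R.card ≤
      e * (2 * ∑ z ∈ R, rootAngle ζ N (z * w)) := by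
  have he' : (0 : ℚ) < e := by exact_mod_cast he
  have hw0 : w ≠ 0 := by rintro rfl; simp [hN.ne'] at hw
  rcases R.eq_empty_or_nonempty with rfl | ⟨z₀, hz₀⟩
  · simp
  have hN0 : ∀ z : ℂ, z ^ N = 1 → z ≠ 0 := by rintro z hz rfl; simp [hN.ne'] at hz
  have hmul : ∀ z ∈ R, (z * w) ^ N = 1 := fun z hz => by rw [mul_pow, hRN z hz, hw, one_mul]
  -- The quotient of two elements of `R` is an `e`-th root of unity, so the angles differ by
  -- multiples of `1 / e`; the angle at `z₀` is the base point.
  have key := Finset.card_mul_le_sum_of_injOn R (fun z => rootAngle ζ N (z * w) - b)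
    (rootAngle ζ N (z₀ * w) - b) (1 / e) (by positivity) (fun z hz => sub_nonneg.2 (hb z hz))
    (fun z hz => by
      have h1 : (z * z₀⁻¹) ^ N = 1 := by rw [mul_pow, inv_pow, hRN z hz, hRN z₀ hz₀]; simp
      have h2 : (z * z₀⁻¹) ^ e = 1 := by
        rw [mul_pow, inv_pow, hR z hz z₀ hz₀, mul_inv_cancel₀]
        exact pow_ne_zero _ (hN0 _ (hRN z₀ hz₀))
      obtain ⟨m, hm⟩ := hζ.exists_mul_rootAngle_eq hN h1 h2
      obtain ⟨m', hm'⟩ := hζ.rootAngle_mul hN h1 (hmul z₀ hz₀)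
      refine ⟨m + m' * e, ?_⟩
      have e1 : z * z₀⁻¹ * (z₀ * w) = z * w := by
        have := hN0 _ (hRN z₀ hz₀)
        field_simp
      rw [e1] at hm'
      have e2 : rootAngle ζ N (z * z₀⁻¹) = m / e := by rw [← hm]; field_simp
      simp only [hm', e2]
      push_cast
      field_simp
      ring)
    (fun z hz z' hz' h => mul_right_cancel₀ hw0 (hζ.rootAngle_injOn hN (hmul z hz) (hmul z' hz')
      (sub_left_injective h)))
  rw [mul_one_div, div_le_iff₀ he', Finset.sum_sub_distrib, Finset.sum_const, nsmul_eq_mul] at key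
  linarith

theorem card_mul_le_sum_rootAngle (hζ : IsPrimitiveRoot ζ N) (hN : 0 < N) {R : Finset ℂ} {e : ℕ}
    (he : 0 < e) (hRN : ∀ z ∈ R, z ^ N = 1) (hR : ∀ z ∈ R, ∀ w ∈ R, z ^ e = w ^ e)
    {w : ℂ} (hw : w ^ N = 1) :
    (R.card : ℚ) * (R.card - 1) ≤ e * (2 * ∑ z ∈ R, rootAngle ζ N (z * w)) := by
  have := hζ.card_mul_le_sum_rootAngle_of_le hN he hRN hR hw (fun z _ => rootAngle_nonneg _)
  linarith

/-- The half of an even exponent sends every primitive root to `-1`. -/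
theorem pow_half_eq_neg_one {z : ℂ} {e : ℕ} (he : 0 < e) (hz : IsPrimitiveRoot z (2 * e)) :
    z ^ e = -1 :=
  (hz.pow (by omega) (mul_comm 2 e)).eq_neg_one_of_two_right

/-- The angles are distinct members of one progression: of step `1 / d` in general, of step `2 / d`
for even `d`, since then all primitive roots share the `d / 2`-th power `-1`. The orders `1, 2, 3,
4, 6` have too few primitive roots for this and are treated by inversion symmetry. -/
theorem sum_rootAngle_ge_of_isHalfSystem (hζ : IsPrimitiveRoot ζ N) (hN : 0 < N) {R : Finset ℂ}
    {d : ℕ} (hd : d = 5 ∨ 7 ≤ d) (hR : IsHalfSystem d R) (hdN : d ∣ N) {w : ℂ} (hw : w ^ N = 1) :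
    1 ≤ ∑ z ∈ R, rootAngle ζ N (z * w) ∨
      (R.card : ℚ) / 12 ≤ ∑ z ∈ R, rootAngle ζ N (z * w) := by
  have hd0 : 0 < d := by omega
  have hprim : ∀ z ∈ R, IsPrimitiveRoot z d := fun z hz => (mem_primitiveRoots hd0).1 (hR.subset hz)
  have hRN : ∀ z ∈ R, z ^ N = 1 := fun z hz => ((hprim z hz).pow_eq_one_iff_dvd N).2 hdN
  have hcard := hR.totient_le hd0
  rcases Nat.even_or_odd' d with ⟨e, rfl | rfl⟩
  · have he : 0 < e := by omega
    have key := hζ.card_mul_le_sum_rootAngle hN he hRN (fun z hz z' hz' => by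
      rw [pow_half_eq_neg_one he (hprim z hz), pow_half_eq_neg_one he (hprim z' hz')]) hw
    have he' : (0 : ℚ) < e := by exact_mod_cast he
    generalize ∑ z ∈ R, rootAngle ζ N (z * w) = S at *
    rcases Nat.totient_half_bound_even (by omega) (by omega) hcard with h | h
    · right
      have h' : (2 * e + 12 : ℚ) ≤ 12 * R.card := by exact_mod_cast h
      have : (R.card : ℚ) * (2 * e) ≤ 12 * (e * (2 * S)) := by
        have h0 : (0 : ℚ) ≤ R.card := by positivity
        nlinarith
      have : (e : ℚ) * R.card ≤ e * (12 * S) := by linarith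
      have := le_of_mul_le_mul_left this he'
      linarith
    · left
      have h' : (R.card + 2 * e : ℚ) ≤ R.card * R.card := by exact_mod_cast h
      have : (e : ℚ) * 1 ≤ e * S := by nlinarith
      exact le_of_mul_le_mul_left this he'
  · have key := hζ.card_mul_le_sum_rootAngle hN hd0 hRN (fun z hz z' hz' => by
      rw [(hprim z hz).pow_eq_one, (hprim z' hz').pow_eq_one]) hw
    have he' : (0 : ℚ) < ((2 * e + 1 : ℕ) : ℚ) := by exact_mod_cast hd0
    generalize ∑ z ∈ R, rootAngle ζ N (z * w) = S at *
    rcases Nat.totient_half_bound_odd (by omega) (by omega) hcard with h | h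
    · right
      have h' : (((2 * e + 1 : ℕ) : ℚ) + 6 : ℚ) ≤ 6 * R.card := by exact_mod_cast h
      generalize ((2 * e + 1 : ℕ) : ℚ) = D at *
      have : (R.card : ℚ) * D ≤ 6 * (D * (2 * S)) := by
        have h0 : (0 : ℚ) ≤ R.card := by positivity
        nlinarith
      have : D * R.card ≤ D * (12 * S) := by linarith
      have := le_of_mul_le_mul_left this he'
      linarith
    · left
      have h' : (R.card + 2 * ((2 * e + 1 : ℕ) : ℚ) : ℚ) ≤ R.card * R.card := by exact_mod_cast h
      generalize ((2 * e + 1 : ℕ) : ℚ) = D at *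
      have : D * 1 ≤ D * S := by nlinarith
      exact le_of_mul_le_mul_left this he'

/-- The angle sum over a set of roots of unity closed under inversion. -/
theorem sum_rootAngle_ge_of_inv_mem (hζ : IsPrimitiveRoot ζ N) (hN : 0 < N) {R : Finset ℂ}
    (hRN : ∀ z ∈ R, z ^ N = 1) (hR : ∀ z ∈ R, z⁻¹ ∈ R) {w : ℂ} (hw : w ^ N = 1) :
    R.card * (rootAngle ζ N (w * w) / 2) ≤ ∑ z ∈ R, rootAngle ζ N (z * w) := by
  have e : ∑ z ∈ R, rootAngle ζ N (z * w) = ∑ z ∈ R, rootAngle ζ N (z⁻¹ * w) :=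
    Finset.sum_bij' (fun z _ => z⁻¹) (fun z _ => z⁻¹) hR hR (by simp) (by simp) (by simp)
  have h : ∑ _z ∈ R, rootAngle ζ N (w * w) ≤
      ∑ z ∈ R, (rootAngle ζ N (z * w) + rootAngle ζ N (z⁻¹ * w)) :=
    Finset.sum_le_sum fun z hz => hζ.rootAngle_sq_le hN (hRN z hz) hw
  rw [Finset.sum_add_distrib, ← e, Finset.sum_const, nsmul_eq_mul] at h
  linarith

end IsPrimitiveRoot

/-! ### Angle sums relative to an element, and the bound one half -/

namespace IsPrimitiveRoot

variable {ζ : ℂ} {N : ℕ}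

theorem rootAngle_pow_div (hζ : IsPrimitiveRoot ζ N) (hN : 0 < N) {r q : ℕ} (hr : N = q * r)
    (e : ℕ) : rootAngle ζ N ((ζ ^ q) ^ e) = ((e % r : ℕ) : ℚ) / r := by
  rw [← pow_mul, hζ.rootAngle_pow hN, hr, ← Int.fract_div_natCast_eq_div_natCast_mod]
  have hq : (q : ℚ) ≠ 0 := by
    rintro h
    have : q = 0 := by exact_mod_cast h
    simp [this] at hr; omega
  push_cast
  rw [mul_div_mul_left _ _ hq]

theorem sum_primitiveRoots_eq {η : ℂ} {r : ℕ} (hη : IsPrimitiveRoot η r) (hr : 0 < r)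
    (F : ℂ → ℚ) :
    ∑ z ∈ primitiveRoots r ℂ, F z = ∑ u ∈ Finset.range r with r.Coprime u, F (η ^ u) := by
  symm
  refine Finset.sum_bij (fun u _ => η ^ u) ?_ ?_ ?_ (fun _ _ => rfl)
  · intro u hu
    rw [Finset.mem_filter] at hu
    exact (mem_primitiveRoots hr).2 (hη.pow_of_coprime u hu.2.symm)
  · intro u hu v hv h
    simp only [Finset.mem_filter, Finset.mem_range] at hu hv
    exact hη.pow_inj hu.1 hv.1 h
  · intro z hz
    have : NeZero r := ⟨hr.ne'⟩
    obtain ⟨i, hi, hc, rfl⟩ := hη.isPrimitiveRoot_iff.1 ((mem_primitiveRoots hr).1 hz)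
    exact ⟨i, Finset.mem_filter.2 ⟨Finset.mem_range.2 hi, hc.symm⟩, rfl⟩

theorem one_le_sum_of_isHalfSystem_of_le (hζ : IsPrimitiveRoot ζ N) (hN : 0 < N) {R : Finset ℂ}
    {d : ℕ} (hd : 60 < d) (hR : IsHalfSystem d R) (hdN : d ∣ N) {w : ℂ} (hw : w ^ N = 1) :
    1 ≤ ∑ z ∈ R, rootAngle ζ N (z * w) := by
  have hd0 : 0 < d := by omega
  have hprim : ∀ z ∈ R, IsPrimitiveRoot z d := fun z hz => (mem_primitiveRoots hd0).1 (hR.subset hz)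
  have hRN : ∀ z ∈ R, z ^ N = 1 := fun z hz => ((hprim z hz).pow_eq_one_iff_dvd N).2 hdN
  have hcard := hR.totient_le hd0
  have hmul : d.totient * (d.totient - 2) ≤ 4 * (R.card * R.card - R.card) := by
    refine (Nat.mul_le_mul hcard (Nat.sub_le_sub_right hcard 2)).trans_eq ?_
    rw [Nat.mul_sub, Nat.mul_sub]
    congr 1 <;> ring
  have hself : R.card ≤ R.card * R.card := Nat.le_mul_self _
  rcases Nat.even_or_odd' d with ⟨e, rfl | rfl⟩
  · have he : 0 < e := by omega
    have key := hζ.card_mul_le_sum_rootAngle hN he hRN (fun z hz z' hz' => by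
      rw [pow_half_eq_neg_one he (hprim z hz), pow_half_eq_neg_one he (hprim z' hz')]) hw
    have he' : (0 : ℚ) < e := by exact_mod_cast he
    generalize ∑ z ∈ R, rootAngle ζ N (z * w) = S at *
    have h := Nat.four_mul_le_totient_mul hd
    have h2 : R.card + 2 * e ≤ R.card * R.card := by omega
    have h' : (R.card + 2 * e : ℚ) ≤ R.card * R.card := by exact_mod_cast h2
    have : (e : ℚ) * 1 ≤ e * S := by nlinarith
    exact le_of_mul_le_mul_left this he'
  · have key := hζ.card_mul_le_sum_rootAngle hN hd0 hRN (fun z hz z' hz' => by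
      rw [(hprim z hz).pow_eq_one, (hprim z' hz').pow_eq_one]) hw
    have he' : (0 : ℚ) < ((2 * e + 1 : ℕ) : ℚ) := by exact_mod_cast hd0
    generalize ∑ z ∈ R, rootAngle ζ N (z * w) = S at *
    have h := Nat.eight_mul_le_totient_mul_of_odd (d := 2 * e + 1) (by omega) (by omega)
    have h2 : R.card + 2 * (2 * e + 1) ≤ R.card * R.card := by omega
    have h' : (R.card + 2 * ((2 * e + 1 : ℕ) : ℚ) : ℚ) ≤ R.card * R.card := by exact_mod_cast h2
    generalize ((2 * e + 1 : ℕ) : ℚ) = D at *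
    have : D * 1 ≤ D * S := by nlinarith
    exact le_of_mul_le_mul_left this he'

/-- The sum of the angles of a half system relative to one of its elements. -/
theorem relative_sum_of_isHalfSystem (hζ : IsPrimitiveRoot ζ N) (hN : 0 < N) {R : Finset ℂ}
    {r : ℕ} (hr : 7 ≤ r) (hR : IsHalfSystem r R) (hrN : r ∣ N) {τ : ℂ} (hτ : IsPrimitiveRoot τ r)
    (hy : 6 * rootAngle ζ N (τ⁻¹ * τ⁻¹) < 1) :
    -- The coefficient `7` is `1 + 12 / 2`: the angle `y` of `τ⁻²` itself, plus `y / 2` for each of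
    -- twelve roots. The sum that follows is the excess of the orbit over the average `y / 2`.
    1 ≤ ∑ z ∈ R, rootAngle ζ N (z * τ⁻¹) ∨
      1 ≤ 7 * rootAngle ζ N (τ⁻¹ * τ⁻¹) +
        ∑ z ∈ R, (rootAngle ζ N (z * τ⁻¹) - rootAngle ζ N (τ⁻¹ * τ⁻¹) / 2) := by
  have hr0 : 0 < r := by omega
  have hτN : τ⁻¹ ^ N = 1 := by rw [inv_pow, (hτ.pow_eq_one_iff_dvd N).2 hrN, inv_one]
  rcases lt_or_ge 60 r with h60 | h60
  · exact Or.inl (hζ.one_le_sum_of_isHalfSystem_of_le hN h60 hR hrN hτN)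
  right
  obtain ⟨q, hq⟩ := hrN
  rw [mul_comm] at hq
  have hη : IsPrimitiveRoot (ζ ^ q) r := hζ.pow hN hq
  obtain ⟨a, ha, hac, rfl⟩ := (haveI : NeZero r := ⟨hr0.ne'⟩; hη.isPrimitiveRoot_iff.1 hτ)
  have hang := hζ.rootAngle_pow_div hN hq
  have hsum := hη.sum_primitiveRoots_eq hr0
  have hη0 : ζ ^ q ≠ 0 := hη.ne_zero hr0.ne'
  have hη1 := hη.pow_eq_one
  generalize ζ ^ q = η at *
  have hinv : (η ^ a)⁻¹ = η ^ (r - a) := by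
    refine inv_eq_of_mul_eq_one_right ?_
    rw [← pow_add, Nat.add_sub_cancel' ha.le, hη1]
  rw [hinv] at hy hτN ⊢
  have ey : rootAngle ζ N (η ^ (r - a) * η ^ (r - a)) = ((2 * (r - a) % r : ℕ) : ℚ) / r := by
    rw [← pow_add, ← two_mul, hang]
  rw [ey] at hy ⊢
  have hr' : (0 : ℚ) < r := by exact_mod_cast hr0
  -- A zero residue would give `r ∣ 2 * a` with `a` prime to `r`, hence `r ≤ 2`.
  have hpos : 0 < 2 * (r - a) % r := by
    rw [Nat.pos_iff_ne_zero]
    intro h0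
    have h1 : r ∣ 2 * a := by
      have h2 : r ∣ 2 * (r - a) := Nat.dvd_of_mod_eq_zero h0
      have h3 : 2 * (r - a) + 2 * a = 2 * r := by omega
      exact (Nat.dvd_add_right h2).1 (h3 ▸ Dvd.intro_left 2 rfl)
    have h2 := Nat.le_of_dvd (by norm_num) (hac.symm.dvd_of_dvd_mul_right h1)
    omega
  have hsmall : 6 * (2 * (r - a) % r) < r := by
    rw [mul_div_assoc', div_lt_one hr'] at hy
    exact_mod_cast hy
  have hbound := Nat.sum_min_residue_bound hr (by omega) ha hpos hsmall hac.symm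
  set Y : ℕ := 2 * (r - a) % r with hY
  -- Subtracting `y / 2` is admissible because the angles of `z * τ⁻¹` and `z⁻¹ * τ⁻¹` add up to at
  -- least `y`.
  have hmin := hR.sum_min_le hr0 (fun z => rootAngle ζ N (z * η ^ (r - a)) - (Y : ℚ) / r / 2)
    (fun z hz => by
      have hzN : z ^ N = 1 := (((mem_primitiveRoots hr0).1 hz).pow_eq_one_iff_dvd N).2
        (hq ▸ Dvd.intro_left q rfl)
      have := hζ.rootAngle_sq_le hN hzN hτN
      rw [ey] at this
      linarith)
  rw [hsum] at hmin
  have hterm : ∀ u ∈ (Finset.range r).filter (fun u => r.Coprime u),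
      min (rootAngle ζ N (η ^ u * η ^ (r - a)) - (Y : ℚ) / r / 2)
        (rootAngle ζ N ((η ^ u)⁻¹ * η ^ (r - a)) - (Y : ℚ) / r / 2) =
      ((2 * min ((u + (r - a)) % r) ((2 * r - u - a) % r) : ℕ) : ℚ) / r / 2 - (Y : ℚ) / r / 2 := by
    intro u hu
    have hu' := Finset.mem_range.1 (Finset.mem_filter.1 hu).1
    have e1 : (η ^ u)⁻¹ * η ^ (r - a) = η ^ (2 * r - u - a) := by
      rw [inv_mul_eq_iff_eq_mul₀ (pow_ne_zero _ hη0), ← pow_add,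
        show u + (2 * r - u - a) = r + (r - a) by omega, pow_add, hη1, one_mul]
    rw [e1, ← pow_add, hang, hang, min_sub_sub_right, min_div_div_right hr'.le]
    push_cast
    field_simp
  rw [Finset.sum_congr rfl hterm, Finset.sum_sub_distrib, Finset.sum_const, ← Finset.sum_div,
    ← Finset.sum_div] at hmin
  have hcard : ((Finset.range r).filter (fun u => r.Coprime u)).card = r.totient := rfl
  rw [hcard, nsmul_eq_mul, ← Nat.cast_sum] at hmin
  have hb' := (Nat.cast_le (α := ℚ)).2 hbound
  rw [Nat.cast_add, Nat.cast_add, Nat.cast_mul, Nat.cast_mul, Nat.cast_mul] at hb'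
  generalize (((∑ u ∈ Finset.range r with r.Coprime u,
    2 * min ((u + (r - a)) % r) ((2 * r - u - a) % r) : ℕ) : ℕ) : ℚ) = B at *
  generalize ∑ z ∈ R, (rootAngle ζ N (z * η ^ (r - a)) - (Y : ℚ) / r / 2) = S at *
  have h4 : (4 : ℚ) + r.totient * (Y / r) ≤ 28 * (Y / r) + B / r := by
    have := div_le_div_of_nonneg_right hb' hr'.le
    push_cast at this
    rw [add_div, add_div, mul_div_cancel_right₀ _ hr'.ne'] at this
    rw [mul_div_assoc', mul_div_assoc']
    exact this
  linarith

end IsPrimitiveRoot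

namespace IsPrimitiveRoot

variable {ζ : ℂ} {N : ℕ}

theorem one_le_sum_of_mem_of_inv_mem (hζ : IsPrimitiveRoot ζ N) (hN : 0 < N) {R : Finset ℂ}
    {z : ℂ} (hz : z ∈ R) (hz' : z⁻¹ ∈ R) (hzN : z ^ N = 1) (h1 : z ^ 2 ≠ 1) :
    1 ≤ ∑ z ∈ R, rootAngle ζ N z := by
  classical
  have h0 : z ≠ 0 := by rintro rfl; simp [hN.ne'] at hzN
  have hne : z ≠ z⁻¹ := fun h => h1 (by
    rw [sq]; nth_rewrite 2 [h]; exact mul_inv_cancel₀ h0)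
  have hz1 : z ≠ 1 := by rintro rfl; simp at h1
  rw [← hζ.rootAngle_add_inv hN hzN hz1, ← Finset.sum_pair (f := rootAngle ζ N) hne]
  refine Finset.sum_le_sum_of_subset_of_nonneg ?_ fun _ _ _ => rootAngle_nonneg _
  intro w hw
  rcases Finset.mem_insert.1 hw with rfl | hw
  · exact hz
  · rw [Finset.mem_singleton.1 hw]; exact hz'

theorem inv_le_rootAngle (hζ : IsPrimitiveRoot ζ N) (hN : 0 < N) {z : ℂ} (hzN : z ^ N = 1)
    {d : ℕ} (hd : 0 < d) (hzd : z ^ d = 1) (h1 : z ≠ 1) : 1 / (d : ℚ) ≤ rootAngle ζ N z := by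
  have hd' : (0 : ℚ) < d := by exact_mod_cast hd
  obtain ⟨m, hm⟩ := hζ.exists_mul_rootAngle_eq hN hzN hzd
  have h2 := mul_pos hd' (hζ.rootAngle_pos hN hzN h1)
  rw [hm] at h2
  have h3 : 1 ≤ m := by exact_mod_cast h2
  have h4 : (1 : ℚ) ≤ m := by exact_mod_cast h3
  rw [div_le_iff₀ hd']
  linarith

/-- Angles of nontrivial `d`-th roots of unity are at least `1 / d`, which sharpens the progression
bound. The excluded orders are genuine: for `d = 8`, the exponents `1, 3` give exactly `1/2`. The
point of passing `1/2` is that for a Galois orbit the sum is a half-integer. -/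
theorem half_lt_sum_of_isHalfSystem (hζ : IsPrimitiveRoot ζ N) (hN : 0 < N) {R : Finset ℂ}
    {d : ℕ} (hd : d = 5 ∨ 7 ≤ d) (h8 : d ≠ 8) (h10 : d ≠ 10) (h12 : d ≠ 12)
    (hR : IsHalfSystem d R) (hdN : d ∣ N) : 1 < 2 * ∑ z ∈ R, rootAngle ζ N z := by
  have hd0 : 0 < d := by omega
  have hd' : (0 : ℚ) < d := by exact_mod_cast hd0
  have hprim : ∀ z ∈ R, IsPrimitiveRoot z d := fun z hz => (mem_primitiveRoots hd0).1 (hR.subset hz)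
  have hRN : ∀ z ∈ R, z ^ N = 1 := fun z hz => ((hprim z hz).pow_eq_one_iff_dvd N).2 hdN
  have hcard := hR.totient_le hd0
  have hle : ∀ z ∈ R, 1 / (d : ℚ) ≤ rootAngle ζ N (z * 1) := fun z hz => by
    rw [mul_one]
    exact hζ.inv_le_rootAngle hN (hRN z hz) hd0 (hprim z hz).pow_eq_one
      ((hprim z hz).ne_one (by omega))
  -- For `d = 18` the progression bound gives only `1/2`. The minima over the primitive exponents
  -- `1, 5, 7, 11, 13, 17` sum to `2 * (1 + 5 + 7) = 26`, and `26 > 18`.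
  rcases eq_or_ne d 18 with h18 | h18
  · have hmin := hR.sum_min_le hd0 (rootAngle ζ N)
      (fun z _ => add_nonneg (rootAngle_nonneg _) (rootAngle_nonneg _))
    obtain ⟨q, hq⟩ := hdN
    rw [mul_comm] at hq
    have hη : IsPrimitiveRoot (ζ ^ q) d := hζ.pow hN hq
    have hη0 : ζ ^ q ≠ 0 := hη.ne_zero hd0.ne'
    rw [hη.sum_primitiveRoots_eq hd0] at hmin
    have hterm : ∀ u ∈ (Finset.range d).filter (fun u => d.Coprime u),
        min (rootAngle ζ N ((ζ ^ q) ^ u)) (rootAngle ζ N ((ζ ^ q) ^ u)⁻¹) =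
        ((min (u % d) ((d - u) % d) : ℕ) : ℚ) / d := by
      intro u hu
      have hu' := Finset.mem_range.1 (Finset.mem_filter.1 hu).1
      have e1 : ((ζ ^ q) ^ u)⁻¹ = (ζ ^ q) ^ (d - u) := by
        refine inv_eq_of_mul_eq_one_right ?_
        rw [← pow_add, Nat.add_sub_cancel' hu'.le, hη.pow_eq_one]
      rw [e1, hζ.rootAngle_pow_div hN hq, hζ.rootAngle_pow_div hN hq, min_div_div_right hd'.le]
      push_cast
      rfl
    rw [Finset.sum_congr rfl hterm, ← Finset.sum_div, ← Nat.cast_sum] at hmin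
    have hval : ∑ u ∈ Finset.range d with d.Coprime u, min (u % d) ((d - u) % d) = 26 := by
      subst h18; decide
    rw [hval, h18] at hmin
    norm_num at hmin
    linarith
  rcases Nat.even_or_odd' d with ⟨e, rfl | rfl⟩
  · have he : 0 < e := by omega
    have key := hζ.card_mul_le_sum_rootAngle_of_le hN he hRN (fun z hz z' hz' => by
      rw [pow_half_eq_neg_one he (hprim z hz), pow_half_eq_neg_one he (hprim z' hz')])
      (one_pow N) hle
    simp only [mul_one] at key
    have he' : (0 : ℚ) < e := by exact_mod_cast he
    have hm := Nat.lt_totient_half_even (by omega) (by omega) h18 hcard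
    have hm' : (2 * e : ℚ) < 2 * (R.card * R.card) := by exact_mod_cast hm
    have e1 : 2 * (e : ℚ) * (1 / (2 * e : ℕ)) * R.card = R.card := by
      push_cast; field_simp
    rw [e1] at key
    refine lt_of_mul_lt_mul_left (a := (e : ℚ)) ?_ he'.le
    linarith
  · have key := hζ.card_mul_le_sum_rootAngle_of_le hN hd0 hRN (fun z hz z' hz' => by
      rw [(hprim z hz).pow_eq_one, (hprim z' hz').pow_eq_one]) (one_pow N) hle
    simp only [mul_one] at key
    have hm := Nat.lt_totient_half_odd (by omega) (by omega) hcard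
    have hm' : ((2 * e + 1 : ℕ) : ℚ) < R.card * (R.card + 1) := by exact_mod_cast hm
    have e1 : 2 * ((2 * e + 1 : ℕ) : ℚ) * (1 / (2 * e + 1 : ℕ)) * R.card = 2 * R.card := by
      field_simp
    rw [e1] at key
    refine lt_of_mul_lt_mul_left (a := ((2 * e + 1 : ℕ) : ℚ)) ?_ hd'.le
    linarith

end IsPrimitiveRoot

/-! ### Imaginary quadratic fields without roots of unity other than `±1` -/

open Polynomial

/-- The properties of the imaginary quadratic fields `ℚ(√D)`, `D < -3`, that control the Galois
orbits of roots of unity. -/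
structure IsGenericImaginary (K : IntermediateField ℚ ℂ) : Prop where
  conj_mem : ∀ z ∈ K, conj z ∈ K
  rational_of_real : ∀ z ∈ K, conj z = z → ∃ q : ℚ, (q : ℂ) = z
  root_of_unity : ∀ z ∈ K, ∀ m : ℕ, 0 < m → z ^ m = 1 → z = 1 ∨ z = -1
  sq_ne : ∀ z ∈ K, z ^ 2 ≠ -2

/-- In lowest terms, the squared numerator divides `c` and the squared denominator divides `d`, so
both are `1`. This identifies `|D|` from a single equation and excludes `|D| = 1, 2, 3`. -/
theorem Squarefree.eq_of_rat_sq_mul_eq {d c : ℕ} (hd : Squarefree d) (hc : Squarefree c) {q : ℚ}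
    (h : q ^ 2 * d = c) : d = c := by
  have hden : (q.den : ℚ) ≠ 0 := by exact_mod_cast q.den_nz
  have h1 : (q.num : ℚ) ^ 2 * d = c * (q.den : ℚ) ^ 2 := by
    rw [← h]
    nth_rewrite 2 [← Rat.num_div_den q]
    field_simp
  have h2 : q.num ^ 2 * d = c * (q.den : ℤ) ^ 2 := by exact_mod_cast h1
  have h3 : q.num.natAbs ^ 2 * d = c * q.den ^ 2 := by
    zify
    rw [sq_abs]
    exact h2
  have hcop : Nat.Coprime (q.num.natAbs ^ 2) (q.den ^ 2) := Nat.Coprime.pow 2 2 q.reduced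
  have h4 : q.num.natAbs ^ 2 ∣ c := hcop.dvd_of_dvd_mul_right (h3 ▸ dvd_mul_right _ _)
  have h5 : q.den ^ 2 ∣ d := hcop.symm.dvd_of_dvd_mul_left (h3 ▸ dvd_mul_left _ _)
  have h6 : q.num.natAbs = 1 := Nat.isUnit_iff.1 (hc _ (by rwa [← sq]))
  have h7 : q.den = 1 := Nat.isUnit_iff.1 (hd _ (by rwa [← sq]))
  rw [h6, h7] at h3
  simpa using h3

namespace BallQuotient

/-- The generator `√D` of `QuadField D`. -/
noncomputable def sqrtGen (D : ℤ) : ℂ := Complex.I * ((Real.sqrt (-(D : ℝ)) : ℝ) : ℂ)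

theorem sqrtGen_sq {D : ℤ} (hD : D < 0) : sqrtGen D ^ 2 = D := by
  have h : (0 : ℝ) ≤ -(D : ℝ) := by
    have : (D : ℝ) < 0 := by exact_mod_cast hD
    linarith
  rw [sqrtGen, mul_pow, Complex.I_sq, ← Complex.ofReal_pow, Real.sq_sqrt h]
  push_cast
  ring

theorem conj_sqrtGen (D : ℤ) : conj (sqrtGen D) = -sqrtGen D := by
  rw [sqrtGen, map_mul, Complex.conj_I, Complex.conj_ofReal]
  ring

theorem sqrtGen_mem (D : ℤ) : sqrtGen D ∈ QuadField D :=
  IntermediateField.subset_adjoin ℚ _ rfl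

theorem mem_quadField_iff {D : ℤ} (hD : D < 0) {z : ℂ} :
    z ∈ QuadField D ↔ ∃ a b : ℚ, z = a + b * sqrtGen D := by
  have hδ := sqrtGen_sq hD
  constructor
  · intro hz
    induction hz using IntermediateField.adjoin_induction with
    | mem x hx => exact ⟨0, 1, by rw [Set.mem_singleton_iff.1 hx, sqrtGen]; simp⟩
    | algebraMap x => exact ⟨x, 0, by simp⟩
    | add x y _ _ hx hy =>
      obtain ⟨a, b, rfl⟩ := hx
      obtain ⟨a', b', rfl⟩ := hy
      exact ⟨a + a', b + b', by push_cast; ring⟩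
    | inv x _ hx =>
      obtain ⟨a, b, rfl⟩ := hx
      rcases eq_or_ne ((a : ℂ) + b * sqrtGen D) 0 with h0 | h0
      · exact ⟨0, 0, by rw [h0]; simp⟩
      · have hn : ((a ^ 2 - b ^ 2 * D : ℚ) : ℂ) = (a + b * sqrtGen D) * (a - b * sqrtGen D) := by
          push_cast
          linear_combination (b : ℂ) ^ 2 * hδ
        have h1 : (a : ℂ) - b * sqrtGen D ≠ 0 := by
          intro h1
          have : conj ((a : ℂ) + b * sqrtGen D) = 0 := by
            rw [map_add, map_mul, conj_sqrtGen, ← h1]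
            simp [sub_eq_add_neg]
          exact h0 ((map_eq_zero _).1 this)
        refine ⟨a / (a ^ 2 - b ^ 2 * D), -b / (a ^ 2 - b ^ 2 * D), ?_⟩
        rw [Rat.cast_div, Rat.cast_div, hn]
        field_simp
        push_cast
        ring
    | mul x y _ _ hx hy =>
      obtain ⟨a, b, rfl⟩ := hx
      obtain ⟨a', b', rfl⟩ := hy
      refine ⟨a * a' + b * b' * D, a * b' + b * a', ?_⟩
      push_cast
      linear_combination (b : ℂ) * b' * hδ
  · rintro ⟨a, b, rfl⟩
    exact add_mem ((QuadField D).algebraMap_mem a)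
      (mul_mem ((QuadField D).algebraMap_mem b) (sqrtGen_mem D))

theorem isGenericImaginary_quadField {D : ℤ} (hD : Squarefree D) (hD3 : D < -3) :
    IsGenericImaginary (QuadField D) := by
  have hD0 : D < 0 := by omega
  have hδ := sqrtGen_sq hD0
  have hδ0 : sqrtGen D ≠ 0 := by
    intro h
    rw [h] at hδ
    have : (D : ℂ) = 0 := by rw [← hδ]; simp
    have : D = 0 := by exact_mod_cast this
    omega
  have hd : Squarefree D.natAbs := Int.squarefree_natAbs.2 hD
  have hdc : ((D.natAbs : ℕ) : ℚ) = -(D : ℚ) := by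
    rw [Nat.cast_natAbs, abs_of_neg hD0]
    push_cast
    rfl
  have hcj : ∀ a b : ℚ, conj ((a : ℂ) + b * sqrtGen D) = a - b * sqrtGen D := by
    intro a b
    rw [map_add, map_mul, conj_sqrtGen]
    simp [sub_eq_add_neg]
  have hnorm : ∀ a b : ℚ, conj ((a : ℂ) + b * sqrtGen D) * (a + b * sqrtGen D) =
      ((a ^ 2 + b ^ 2 * D.natAbs : ℚ) : ℂ) := by
    intro a b
    rw [hcj, hdc]
    push_cast
    linear_combination -(b : ℂ) ^ 2 * hδ
  refine ⟨?_, ?_, ?_, ?_⟩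
  · intro z hz
    obtain ⟨a, b, rfl⟩ := (mem_quadField_iff hD0).1 hz
    rw [hcj]
    exact (mem_quadField_iff hD0).2 ⟨a, -b, by push_cast; ring⟩
  · intro z hz hc
    obtain ⟨a, b, rfl⟩ := (mem_quadField_iff hD0).1 hz
    rw [hcj] at hc
    have h1 : (b : ℂ) * sqrtGen D = 0 := by linear_combination (-1 / 2 : ℂ) * hc
    exact ⟨a, by rw [h1, add_zero]⟩
  · intro z hz m hm hzm
    obtain ⟨a, b, rfl⟩ := (mem_quadField_iff hD0).1 hz
    have hn : a ^ 2 + b ^ 2 * D.natAbs = 1 := by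
      have h1 := hnorm a b
      rw [Complex.conj_mul', Complex.norm_eq_one_of_pow_eq_one hzm hm.ne'] at h1
      have h2 : ((a ^ 2 + b ^ 2 * D.natAbs : ℚ) : ℂ) = ((1 : ℚ) : ℂ) := by
        rw [← h1]; simp
      exact_mod_cast h2
    -- The trace `2 * a` is a rational algebraic integer, and norm one bounds it by `2` in absolute
    -- value; five values remain.
    have hint : IsIntegral ℤ ((2 * a : ℚ) : ℂ) := by
      have h1 : IsIntegral ℤ ((a : ℂ) + b * sqrtGen D) :=
        IsIntegral.of_pow hm (by rw [hzm]; exact isIntegral_one)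
      have h2 : IsIntegral ℤ (conj ((a : ℂ) + b * sqrtGen D)) :=
        IsIntegral.of_pow hm (by rw [← map_pow, hzm, map_one]; exact isIntegral_one)
      have h3 := h1.add h2
      rw [hcj] at h3
      have e : (a : ℂ) + b * sqrtGen D + (a - b * sqrtGen D) = ((2 * a : ℚ) : ℂ) := by
        push_cast; ring
      rwa [e] at h3
    have hint' : IsIntegral ℤ (2 * a : ℚ) :=
      (isIntegral_algebraMap_iff (B := ℂ) (algebraMap ℚ ℂ).injective).1 (by simpa using hint)
    obtain ⟨t, ht⟩ := IsIntegrallyClosed.isIntegral_iff.1 hint'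
    have ht' : (t : ℚ) = 2 * a := by simpa using ht
    have hbn : 0 ≤ b ^ 2 * (D.natAbs : ℚ) := by positivity
    have hab : a ^ 2 ≤ 1 := by linarith
    have hta : (t : ℚ) ^ 2 ≤ 4 := by rw [ht']; linarith
    have hti : t ^ 2 ≤ 4 := by exact_mod_cast hta
    have hlo : -2 ≤ t := by nlinarith
    have hhi : t ≤ 2 := by nlinarith
    have hdpos : (0 : ℚ) < D.natAbs := by
      rw [hdc]
      have : (D : ℚ) < 0 := by exact_mod_cast hD0
      linarith
    have hb0 : a ^ 2 = 1 → b = 0 := by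
      intro h
      have : b ^ 2 * (D.natAbs : ℚ) = 0 := by linarith
      rcases mul_eq_zero.1 this with h | h
      · exact pow_eq_zero_iff (two_ne_zero) |>.1 h
      · exact absurd h hdpos.ne'
    -- Trace `±1` would give `(2 * b) ^ 2 * |D| = 3`, that is, `D = -3`.
    have hthree : a ^ 2 = 1 / 4 → False := by
      intro h
      have h1 : (2 * b) ^ 2 * (D.natAbs : ℚ) = (3 : ℕ) := by push_cast; linarith
      have := hd.eq_of_rat_sq_mul_eq Nat.prime_three.squarefree h1
      omega
    have hcase : t = -2 ∨ t = -1 ∨ t = 0 ∨ t = 1 ∨ t = 2 := by omega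
    rcases hcase with rfl | rfl | rfl | rfl | rfl
    · right
      have ha : a = -1 := by push_cast at ht'; linarith
      rw [hb0 (by rw [ha]; norm_num), ha]; simp
    · have ha : a = -1 / 2 := by push_cast at ht'; linarith
      exact (hthree (by rw [ha]; norm_num)).elim
    · have ha : a = 0 := by push_cast at ht'; linarith
      have h1 : b ^ 2 * (D.natAbs : ℚ) = (1 : ℕ) := by
        rw [ha] at hn; push_cast; linarith
      have := hd.eq_of_rat_sq_mul_eq squarefree_one h1
      omega
    · have ha : a = 1 / 2 := by push_cast at ht'; linarith
      exact (hthree (by rw [ha]; norm_num)).elim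
    · left
      have ha : a = 1 := by push_cast at ht'; linarith
      rw [hb0 (by rw [ha]; norm_num), ha]; simp
  · intro z hz h2
    obtain ⟨a, b, rfl⟩ := (mem_quadField_iff hD0).1 hz
    -- Separating rational and imaginary parts forces `a * b = 0`; `a = 0` would give `|D| = 2`, and
    -- `b = 0` a negative rational square.
    have h3 : ((a ^ 2 + b ^ 2 * D + 2 : ℚ) : ℂ) = -((2 * a * b : ℚ) : ℂ) * sqrtGen D := by
      push_cast
      linear_combination h2 - (b : ℂ) ^ 2 * hδ
    have h4 : ((2 * a * b : ℚ) : ℂ) = 0 := by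
      have h5 := congrArg conj h3
      rw [map_mul, map_neg, conj_sqrtGen, map_ratCast, map_ratCast, h3] at h5
      have : ((2 * a * b : ℚ) : ℂ) * sqrtGen D = 0 := by linear_combination (-1 / 2 : ℂ) * h5
      exact (mul_eq_zero.1 this).resolve_right hδ0
    rw [h4, neg_zero, zero_mul] at h3
    have h5 : a ^ 2 + b ^ 2 * D + 2 = 0 := by exact_mod_cast h3
    have h6 : 2 * a * b = 0 := by exact_mod_cast h4
    have h7 : a = 0 ∨ b = 0 := by
      rcases mul_eq_zero.1 h6 with h | h
      · left; linarith
      · exact Or.inr h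
    rcases h7 with rfl | rfl
    · have h1 : b ^ 2 * (D.natAbs : ℚ) = (2 : ℕ) := by rw [hdc]; push_cast; linarith
      have := hd.eq_of_rat_sq_mul_eq Nat.prime_two.squarefree h1
      omega
    · nlinarith [sq_nonneg a]

end BallQuotient

/-! ### Galois orbits of roots of unity over `K` -/

namespace IsGenericImaginary

variable {K : IntermediateField ℚ ℂ}

/-- The product of `p` with its complex conjugate has rational coefficients, so the cyclotomic
polynomial divides it as soon as `p` has one primitive root. Hence `w` is a root of `p` or of its
conjugate, and in the latter case `conj w = w⁻¹` is a root of `p`. -/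
theorem aeval_eq_zero_or (hK : IsGenericImaginary K) {p : K[X]} {z w : ℂ} {d : ℕ} (hd : 0 < d)
    (hz : IsPrimitiveRoot z d) (hw : IsPrimitiveRoot w d) (hp : aeval z p = 0) :
    aeval w p = 0 ∨ aeval w⁻¹ p = 0 := by
  set P : ℂ[X] := p.map (algebraMap K ℂ) with hP
  set Q : ℂ[X] := P * P.map (starRingEnd ℂ) with hQ
  have hPK : ∀ n, P.coeff n ∈ K := fun n => by rw [hP, coeff_map]; exact (p.coeff n).2
  have hPK' : ∀ n, (P.map (starRingEnd ℂ)).coeff n ∈ K := fun n => by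
    rw [coeff_map]; exact hK.conj_mem _ (hPK n)
  have hQK : ∀ n, Q.coeff n ∈ K := fun n => by
    rw [hQ, coeff_mul]
    exact sum_mem fun x _ => mul_mem (hPK _) (hPK' _)
  have hQc : Q.map (starRingEnd ℂ) = Q := by
    rw [hQ, Polynomial.map_mul, mul_comm]
    congr 1
    rw [Polynomial.map_map, show (starRingEnd ℂ).comp (starRingEnd ℂ) = RingHom.id ℂ from
      RingHom.ext fun x => Complex.conj_conj x, Polynomial.map_id]
  have hQr : ∀ n, ∃ q : ℚ, (q : ℂ) = Q.coeff n := fun n =>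
    hK.rational_of_real _ (hQK n) (by
      nth_rewrite 2 [← hQc]
      rw [coeff_map])
  obtain ⟨q, hq⟩ : ∃ q : ℚ[X], q.map (algebraMap ℚ ℂ) = Q :=
    (lifts_iff_coeff_lifts Q).2 fun n => (hQr n).imp fun q hq => by simpa using hq
  have hqz : aeval z q = 0 := by
    rw [aeval_def, ← eval_map, hq, hQ, eval_mul, hP, eval_map, ← aeval_def, hp, zero_mul]
  have hdvd : cyclotomic d ℚ ∣ q := by
    rw [cyclotomic_eq_minpoly_rat hz hd]
    exact minpoly.dvd ℚ z hqz
  have hqw : aeval w q = 0 := by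
    obtain ⟨s, rfl⟩ := hdvd
    have hc : aeval w (cyclotomic d ℚ) = 0 := by
      rw [cyclotomic_eq_minpoly_rat hw hd]
      exact minpoly.aeval ℚ w
    rw [map_mul, hc, zero_mul]
  rw [aeval_def, ← eval_map, hq, hQ, eval_mul, mul_eq_zero] at hqw
  refine hqw.imp (fun h => by rwa [hP, eval_map, ← aeval_def] at h) fun h => ?_
  have hinv : conj w = w⁻¹ :=
    (Complex.inv_eq_conj (Complex.norm_eq_one_of_pow_eq_one hw.pow_eq_one hd.ne')).symm
  have h2 : eval w (P.map (starRingEnd ℂ)) = conj (eval (conj w) P) := by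
    rw [eval_map, eval₂_eq_sum_range, eval_eq_sum_range, map_sum]
    refine Finset.sum_congr rfl fun i _ => ?_
    rw [map_mul, map_pow, Complex.conj_conj]
  rw [h2, map_eq_zero, hinv, hP, eval_map, ← aeval_def] at h
  exact h

/-- The complex roots of an irreducible polynomial over `K`, one of whose roots is a primitive
`d`-th root of unity. -/
theorem isHalfSystem (hK : IsGenericImaginary K) {p : K[X]} (hp : Irreducible p) (hm : p.Monic)
    {z : ℂ} {d : ℕ} (hd : 0 < d) (hz : IsPrimitiveRoot z d) (hpz : aeval z p = 0) :
    IsHalfSystem d (p.aroots ℂ).toFinset := by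
  have hp0 : p ≠ 0 := hp.ne_zero
  refine ⟨fun w hw => ?_, fun w hw => ?_⟩
  · rw [Multiset.mem_toFinset, mem_aroots] at hw
    have h1 : p ∣ cyclotomic d K := by
      rw [minpoly.eq_of_irreducible_of_monic hp hpz hm]
      refine minpoly.dvd K z ?_
      rw [aeval_def, ← eval_map, map_cyclotomic]
      exact hz.isRoot_cyclotomic hd
    obtain ⟨s, hs⟩ := h1
    have h2 : aeval w (cyclotomic d K) = 0 := by rw [hs, map_mul, hw.2, zero_mul]
    rw [aeval_def, ← eval_map, map_cyclotomic] at h2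
    have : NeZero (d : ℂ) := ⟨by exact_mod_cast hd.ne'⟩
    exact (mem_primitiveRoots hd).2 (isRoot_cyclotomic_iff.1 h2)
  · rw [Multiset.mem_toFinset, Multiset.mem_toFinset, mem_aroots, mem_aroots]
    exact (hK.aeval_eq_zero_or hd hz ((mem_primitiveRoots hd).1 hw) hpz).imp
      (fun h => ⟨hp0, h⟩) (fun h => ⟨hp0, h⟩)

theorem nodup_aroots {p : K[X]} (hp : Irreducible p) : (p.aroots ℂ).Nodup :=
  nodup_aroots_iff_of_splits hp.ne_zero (IsAlgClosed.splits _) |>.2 hp.separable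

theorem card_toFinset_aroots {p : K[X]} (hp : Irreducible p) :
    (p.aroots ℂ).toFinset.card = p.natDegree := by
  rw [Multiset.toFinset_card_of_nodup (nodup_aroots hp), aroots,
    (splits_iff_card_roots.1 (IsAlgClosed.splits _)), natDegree_map]

theorem prod_aroots_mem {p : K[X]} (hp : Irreducible p) (hm : p.Monic) :
    ∏ z ∈ (p.aroots ℂ).toFinset, z ∈ K := by
  have h1 := (IsAlgClosed.splits (p.map (algebraMap K ℂ))).coeff_zero_eq_prod_roots_of_monic
    (hm.map _)
  have h2 : ∏ z ∈ (p.aroots ℂ).toFinset, z = (p.aroots ℂ).prod := by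
    rw [Finset.prod_eq_multiset_prod, Multiset.toFinset_val,
      Multiset.dedup_eq_self.2 (nodup_aroots hp), Multiset.map_id']
  rw [h2]
  have h3 : (p.aroots ℂ).prod = (-1) ^ (p.map (algebraMap K ℂ)).natDegree *
      (p.map (algebraMap K ℂ)).coeff 0 := by
    rw [h1, ← mul_assoc, ← mul_pow]
    simp [aroots]
  rw [h3, coeff_map]
  exact mul_mem (pow_mem (neg_mem (one_mem K)) _) (p.coeff 0).2

theorem multiset_sum_aroots_mem {p : K[X]} (hm : p.Monic) : (p.aroots ℂ).sum ∈ K := by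
  have h1 := (IsAlgClosed.splits (p.map (algebraMap K ℂ))).nextCoeff_eq_neg_sum_roots_of_monic
    (hm.map _)
  have h3 : (p.aroots ℂ).sum = -(p.map (algebraMap K ℂ)).nextCoeff := by
    rw [h1, neg_neg, aroots]
  rw [h3, nextCoeff_map (algebraMap K ℂ).injective]
  exact neg_mem (p.nextCoeff).2

theorem sum_aroots_mem {p : K[X]} (hp : Irreducible p) (hm : p.Monic) :
    ∑ z ∈ (p.aroots ℂ).toFinset, z ∈ K := by
  rw [Finset.sum_eq_multiset_sum, Multiset.toFinset_val,
    Multiset.dedup_eq_self.2 (nodup_aroots hp), Multiset.map_id']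
  exact multiset_sum_aroots_mem hm

end IsGenericImaginary

theorem IsHalfSystem.two_mul_card_le {d : ℕ} {R : Finset ℂ} (hR : IsHalfSystem d R) (hd : 0 < d)
    (h : ∀ z ∈ R, z⁻¹ ∉ R) : 2 * R.card ≤ d.totient := by
  classical
  have hdis : Disjoint R (R.image fun z => z⁻¹) := by
    rw [Finset.disjoint_left]
    intro z hz hz'
    obtain ⟨w, hw, rfl⟩ := Finset.mem_image.1 hz'
    exact h w hw hz
  have hsub : R ∪ R.image (fun z => z⁻¹) ⊆ primitiveRoots d ℂ := by
    refine Finset.union_subset hR.subset fun z hz => ?_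
    obtain ⟨w, hw, rfl⟩ := Finset.mem_image.1 hz
    exact IsHalfSystem.inv_mem_primitiveRoots hd (hR.subset hw)
  have := Finset.card_le_card hsub
  rw [Finset.card_union_of_disjoint hdis, Finset.card_image_of_injective _ inv_injective,
    Complex.card_primitiveRoots] at this
  omega

namespace IsGenericImaginary

variable {K : IntermediateField ℚ ℂ}

/-- A Galois orbit of primitive `d`-th roots of unity of small order contains two inverse
elements. -/
theorem exists_inv_mem (hK : IsGenericImaginary K) {d : ℕ} {R : Finset ℂ}
    (hd : d = 3 ∨ d = 4 ∨ d = 6 ∨ d = 8 ∨ d = 10 ∨ d = 12) (hR : IsHalfSystem d R)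
    (hprod : ∏ z ∈ R, z ∈ K) (hsum : ∑ z ∈ R, z ∈ K) : ∃ z ∈ R, z⁻¹ ∈ R := by
  classical
  have hd0 : 0 < d := by omega
  by_contra! hno
  have h1 := hR.two_mul_card_le hd0 hno
  have h2 := hR.totient_le hd0
  have hprim : ∀ z ∈ R, IsPrimitiveRoot z d := fun z hz =>
    (mem_primitiveRoots hd0).1 (hR.subset hz)
  have hcases : (d.totient = 2 ∧ 3 ≤ d) ∨ (d.totient = 4 ∧ (d = 8 ∨ d = 10 ∨ d = 12)) := by
    rcases hd with rfl | rfl | rfl | rfl | rfl | rfl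
    · left; decide
    · left; decide
    · left; decide
    · right; decide
    · right; decide
    · right; decide
  rcases hcases with ⟨ht, hd3⟩ | ⟨ht, hd⟩
  -- Without inverse pairs the orbit has exactly `φ(d) / 2` elements. A single element would lie in
  -- `K` and so be `±1`.
  · obtain ⟨z, rfl⟩ := Finset.card_eq_one.1 (show R.card = 1 by omega)
    have hz := hprim z (Finset.mem_singleton_self z)
    rw [Finset.prod_singleton] at hprod
    have : z ^ 2 = 1 := by
      rcases hK.root_of_unity z hprod d hd0 hz.pow_eq_one with rfl | rfl <;> simp
    exact hz.pow_ne_one_of_pos_of_lt (by norm_num) (by omega) this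
  · obtain ⟨z, w, hzw, rfl⟩ := Finset.card_eq_two.1 (show R.card = 2 by omega)
    rw [Finset.prod_pair hzw] at hprod
    rw [Finset.sum_pair hzw] at hsum
    have hz := hprim z (by simp)
    have hw := hprim w (by simp)
    have hz0 : z ≠ 0 := hz.ne_zero hd0.ne'
    rcases hK.root_of_unity _ hprod d hd0 (by rw [mul_pow, hz.pow_eq_one, hw.pow_eq_one, one_mul])
      with h | h
    · refine hno z (by simp) ?_
      rw [← eq_inv_of_mul_eq_one_right h]; simp
    -- The orbit is `{z, -z⁻¹}`, and its sum lies in `K`. For `d = 8` the square of this sum is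
    -- `-2`, for `d = 12` it is `-1`; for `d = 10` the element `-z⁻¹` would have order `5`.
    · have hwz : w = -z⁻¹ := by
        field_simp
        rw [mul_comm]; exact h
      have hn1 : ∀ e, 0 < e → 2 * e = d → z ^ e = -1 := fun e he hed =>
        IsPrimitiveRoot.pow_half_eq_neg_one he (hed ▸ hz)
      have hsq : (z + w) ^ 2 = z ^ 2 + (z⁻¹) ^ 2 - 2 := by
        rw [hwz]; field_simp; ring
      rcases hd with rfl | rfl | rfl
      · have h4 := hn1 4 (by norm_num) (by norm_num)
        refine hK.sq_ne _ hsum ?_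
        rw [hsq]
        field_simp
        linear_combination h4
      · have h5 := hn1 5 (by norm_num) (by norm_num)
        refine hw.pow_ne_one_of_pos_of_lt (l := 5) (by norm_num) (by norm_num) ?_
        rw [hwz, neg_pow, inv_pow, h5]; norm_num
      · have h6 := hn1 6 (by norm_num) (by norm_num)
        have h7 : (z ^ 2 + 1) * (z ^ 4 - z ^ 2 + 1) = 0 := by linear_combination h6
        have h8 : z ^ 2 + 1 ≠ 0 := fun h9 =>
          hz.pow_ne_one_of_pos_of_lt (l := 4) (by norm_num) (by norm_num) (by
            linear_combination (z ^ 2 - 1) * h9)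
        have h9 := (mul_eq_zero.1 h7).resolve_left h8
        have h10 : (z + w) ^ 2 = -1 := by
          rw [hsq]
          field_simp
          linear_combination h9
        rcases hK.root_of_unity _ hsum 4 (by norm_num) (by
          rw [show (z + w) ^ 4 = ((z + w) ^ 2) ^ 2 by ring, h10]; norm_num) with h | h <;>
        · rw [h] at h10; norm_num at h10

/-- Here `φ(d) ≤ 2`. For `d ≤ 2` every element is its own inverse; otherwise one inverse pair
already exhausts the primitive roots. -/
theorem inv_mem_of_small (hK : IsGenericImaginary K) {d : ℕ} {R : Finset ℂ}
    (hd0 : 0 < d) (hd : d ≤ 4 ∨ d = 6) (hR : IsHalfSystem d R)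
    (hprod : ∏ z ∈ R, z ∈ K) (hsum : ∑ z ∈ R, z ∈ K) : ∀ z ∈ R, z⁻¹ ∈ R := by
  classical
  intro z hz
  have hzd : IsPrimitiveRoot z d := (mem_primitiveRoots hd0).1 (hR.subset hz)
  rcases le_or_gt d 2 with h | h
  · have h2 : z ^ 2 = 1 := by
      have h3 : d = 1 ∨ d = 2 := by omega
      rcases h3 with rfl | rfl
      · rw [IsPrimitiveRoot.one_right_iff.1 hzd]; simp
      · exact hzd.pow_eq_one
    rwa [inv_eq_of_mul_eq_one_right (by rw [← sq]; exact h2)]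
  · have h3 : d = 3 ∨ d = 4 ∨ d = 6 := by omega
    obtain ⟨w, hw, hw'⟩ := hK.exists_inv_mem (by omega) hR hprod hsum
    have hwd : IsPrimitiveRoot w d := (mem_primitiveRoots hd0).1 (hR.subset hw)
    have hne : w ≠ w⁻¹ := fun hh => by
      refine hwd.pow_ne_one_of_pos_of_lt (l := 2) (by norm_num) h ?_
      rw [sq]; nth_rewrite 2 [hh]; exact mul_inv_cancel₀ (hwd.ne_zero hd0.ne')
    have hc : 2 ≤ R.card := by
      rw [← Finset.card_pair hne]
      exact Finset.card_le_card (by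
        intro x hx
        rcases Finset.mem_insert.1 hx with rfl | hx
        · exact hw
        · rw [Finset.mem_singleton.1 hx]; exact hw')
    have ht : d.totient ≤ 2 := by
      rcases h3 with rfl | rfl | rfl <;> decide
    have hall : R = primitiveRoots d ℂ :=
      Finset.eq_of_subset_of_card_le hR.subset (by rw [Complex.card_primitiveRoots]; omega)
    rw [hall]
    exact IsHalfSystem.inv_mem_primitiveRoots hd0 (hR.subset hz)

end IsGenericImaginary

/-! ### Angle sums over the roots of a polynomial over `K` -/

namespace IsGenericImaginary

variable {K : IntermediateField ℚ ℂ} {ζ : ℂ} {N : ℕ}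

theorem sum_map_aroots {p : K[X]} (hp : Irreducible p) (F : ℂ → ℚ) :
    ((p.aroots ℂ).map F).sum = ∑ z ∈ (p.aroots ℂ).toFinset, F z := by
  rw [Finset.sum_eq_multiset_sum, Multiset.toFinset_val,
    Multiset.dedup_eq_self.2 (nodup_aroots hp)]

theorem exists_isHalfSystem (hK : IsGenericImaginary K) (hN : 0 < N) {p : K[X]}
    (hp : Irreducible p) (hm : p.Monic) (hroots : ∀ z ∈ p.aroots ℂ, z ^ N = 1) :
    ∃ d, 0 < d ∧ d ∣ N ∧ IsHalfSystem d (p.aroots ℂ).toFinset := by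
  obtain ⟨z, hz⟩ := IsAlgClosed.exists_aeval_eq_zero ℂ p
    (by rw [degree_eq_natDegree hp.ne_zero]; exact_mod_cast hp.natDegree_pos.ne')
  have hzN := hroots z (mem_aroots.2 ⟨hp.ne_zero, hz⟩)
  have h0 : 0 < orderOf z := orderOf_pos_iff.2 (isOfFinOrder_iff_pow_eq_one.2 ⟨N, hN, hzN⟩)
  exact ⟨orderOf z, h0, orderOf_dvd_of_pow_eq_one hzN,
    hK.isHalfSystem hp hm h0 (IsPrimitiveRoot.orderOf z) hz⟩

/-- The number `v` is a lower bound for the average angle per root, valid for every order: `y / 2`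
comes from inversion symmetry in small orders, with `y` the angle of `w * w`, and `1 / 12` from the
progression bound in the others. Being additive in the degree, the bound passes to products of
irreducible factors. -/
theorem sum_rootAngle_irreducible (hK : IsGenericImaginary K) (hζ : IsPrimitiveRoot ζ N)
    (hN : 0 < N) {p : K[X]} (hp : Irreducible p) (hm : p.Monic)
    (hroots : ∀ z ∈ p.aroots ℂ, z ^ N = 1) {w : ℂ} (hw : w ^ N = 1) {v : ℚ}
    (hv : v ≤ 1 / 12) (hvw : v ≤ rootAngle ζ N (w * w) / 2) :
    1 ≤ ((p.aroots ℂ).map fun z => rootAngle ζ N (z * w)).sum ∨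
      p.natDegree * v ≤ ((p.aroots ℂ).map fun z => rootAngle ζ N (z * w)).sum := by
  rw [sum_map_aroots hp, ← card_toFinset_aroots hp]
  obtain ⟨d, hd, hdN, hR⟩ := hK.exists_isHalfSystem hN hp hm hroots
  have hprod := prod_aroots_mem hp hm
  have hsum := sum_aroots_mem hp hm
  have hroots' : ∀ z ∈ (p.aroots ℂ).toFinset, z ^ N = 1 := fun z hz =>
    hroots z (Multiset.mem_toFinset.1 hz)
  generalize (p.aroots ℂ).toFinset = R at *
  have hc : (0 : ℚ) ≤ R.card := by positivity
  by_cases hsmall : d ≤ 4 ∨ d = 6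
  · right
    have := hζ.sum_rootAngle_ge_of_inv_mem hN hroots'
      (hK.inv_mem_of_small hd hsmall hR hprod hsum) hw
    exact (mul_le_mul_of_nonneg_left hvw hc).trans this
  · rcases hζ.sum_rootAngle_ge_of_isHalfSystem hN (by omega) hR hdN hw with h | h
    · exact Or.inl h
    · right
      have := mul_le_mul_of_nonneg_left hv hc
      linarith

theorem sum_rootAngle_monic (hK : IsGenericImaginary K) (hζ : IsPrimitiveRoot ζ N)
    (hN : 0 < N) {w : ℂ} (hw : w ^ N = 1) {v : ℚ}
    (hv : v ≤ 1 / 12) (hvw : v ≤ rootAngle ζ N (w * w) / 2) (P : K[X]) (hm : P.Monic)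
    (hroots : ∀ z ∈ P.aroots ℂ, z ^ N = 1) :
    1 ≤ ((P.aroots ℂ).map fun z => rootAngle ζ N (z * w)).sum ∨
      P.natDegree * v ≤ ((P.aroots ℂ).map fun z => rootAngle ζ N (z * w)).sum := by
  induction hn : P.natDegree using Nat.strong_induction_on generalizing P with
  | _ n ih =>
    have hnonneg : ∀ Q : K[X], 0 ≤ ((Q.aroots ℂ).map fun z => rootAngle ζ N (z * w)).sum :=
      fun Q => Multiset.sum_nonneg fun x hx => by
        obtain ⟨z, _, rfl⟩ := Multiset.mem_map.1 hx
        exact IsPrimitiveRoot.rootAngle_nonneg _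
    rcases Nat.eq_zero_or_pos n with rfl | hpos
    · right
      simpa using hnonneg P
    · have hu : ¬ IsUnit P := fun h => by
        have := natDegree_eq_zero_of_isUnit h
        omega
      obtain ⟨p, hpm, hp, Q, rfl⟩ := P.exists_monic_irreducible_factor hu
      have hQm : Q.Monic := hpm.of_mul_monic_left hm
      have hdeg : (p * Q).natDegree = p.natDegree + Q.natDegree := hpm.natDegree_mul hQm
      have hroot : (p * Q).aroots ℂ = p.aroots ℂ + Q.aroots ℂ := aroots_mul hm.ne_zero
      rw [hroot] at hroots ⊢
      rw [Multiset.map_add, Multiset.sum_add]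
      have h1 := hK.sum_rootAngle_irreducible hζ hN hp hpm
        (fun z hz => hroots z (Multiset.mem_add.2 (Or.inl hz))) hw hv hvw
      have h2 := ih Q.natDegree (by have := hp.natDegree_pos; omega) Q hQm
        (fun z hz => hroots z (Multiset.mem_add.2 (Or.inr hz))) rfl
      have h3 := hnonneg p
      have h4 := hnonneg Q
      rcases h1 with h1 | h1
      · left; linarith
      rcases h2 with h2 | h2
      · left; linarith
      · right
        rw [← hn, hdeg]
        push_cast
        linarith

/-- The Reid–Tai sum of the roots of `P` relative to one of them, which is not `±1`. -/
theorem one_le_sum_of_root (hK : IsGenericImaginary K) (hζ : IsPrimitiveRoot ζ N)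
    (hN : 0 < N) {P : K[X]} (hm : P.Monic) (hroots : ∀ z ∈ P.aroots ℂ, z ^ N = 1)
    (hdeg : 12 ≤ P.natDegree) {τ : ℂ} (hτ : τ ∈ P.aroots ℂ) (hτ2 : τ ^ 2 ≠ 1) :
    1 ≤ rootAngle ζ N (τ⁻¹ * τ⁻¹) +
      ((P.aroots ℂ).map fun z => rootAngle ζ N (z * τ⁻¹)).sum := by
  have hτN : τ⁻¹ ^ N = 1 := by rw [inv_pow, hroots τ hτ, inv_one]
  have hy0 := IsPrimitiveRoot.rootAngle_nonneg (ζ := ζ) (N := N) (τ⁻¹ * τ⁻¹)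
  have hnonneg : ∀ Q : K[X], 0 ≤ ((Q.aroots ℂ).map fun z => rootAngle ζ N (z * τ⁻¹)).sum :=
    fun Q => Multiset.sum_nonneg fun x hx => by
      obtain ⟨z, _, rfl⟩ := Multiset.mem_map.1 hx
      exact IsPrimitiveRoot.rootAngle_nonneg _
  -- At `y = 1/6` the two bounds `1 / 12` and `y / 2` for the average coincide. Above it, twelve
  -- roots of average `1 / 12` suffice.
  rcases le_or_gt 1 (6 * rootAngle ζ N (τ⁻¹ * τ⁻¹)) with hy | hy
  · have hdeg' : (12 : ℚ) ≤ P.natDegree := by exact_mod_cast hdeg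
    rcases hK.sum_rootAngle_monic hζ hN hτN le_rfl (by linarith) P hm hroots with h | h
    · linarith
    · linarith
  · set y := rootAngle ζ N (τ⁻¹ * τ⁻¹) with hydef
    have hτ0 : aeval τ P = 0 := (mem_aroots.1 hτ).2
    have hint : IsIntegral K τ := ⟨P, hm, by rwa [aeval_def] at hτ0⟩
    obtain ⟨Q, rfl⟩ := minpoly.dvd K τ hτ0
    set p := minpoly K τ with hp
    have hpm : p.Monic := minpoly.monic hint
    have hirr : Irreducible p := minpoly.irreducible hint
    have hQm : Q.Monic := hpm.of_mul_monic_left hm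
    have hdegs : (p * Q).natDegree = p.natDegree + Q.natDegree := hpm.natDegree_mul hQm
    have hroot : (p * Q).aroots ℂ = p.aroots ℂ + Q.aroots ℂ := aroots_mul hm.ne_zero
    have hr0 : 0 < orderOf τ :=
      orderOf_pos_iff.2 (isOfFinOrder_iff_pow_eq_one.2 ⟨N, hN, hroots τ hτ⟩)
    have hrN : orderOf τ ∣ N := orderOf_dvd_of_pow_eq_one (hroots τ hτ)
    rw [hroot] at hroots ⊢
    have hR := hK.isHalfSystem hirr hpm hr0 (IsPrimitiveRoot.orderOf τ) (minpoly.aeval K τ)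
    -- The angle of the nontrivial root of unity `τ⁻²` is at least `1 / orderOf τ` and less than
    -- `1/6`.
    have hr7 : 7 ≤ orderOf τ := by
      have h1 := hζ.inv_le_rootAngle hN (z := τ⁻¹ * τ⁻¹) (by rw [mul_pow, hτN, one_mul]) hr0
        (by rw [mul_pow, inv_pow, pow_orderOf_eq_one]; simp)
        (fun h => hτ2 (by rw [← inv_inj, inv_one, ← h]; ring))
      rw [← hydef] at h1
      have h2 : (0 : ℚ) < orderOf τ := by exact_mod_cast hr0
      rw [div_le_iff₀ h2] at h1
      have h3 : (6 : ℚ) < orderOf τ := by nlinarith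
      exact_mod_cast h3
    have hmain := hζ.relative_sum_of_isHalfSystem hN hr7 hR hrN (IsPrimitiveRoot.orderOf τ) hy
    rw [← sum_map_aroots hirr, Finset.sum_sub_distrib, ← sum_map_aroots hirr, Finset.sum_const,
      card_toFinset_aroots hirr, nsmul_eq_mul] at hmain
    have hQ := hK.sum_rootAngle_monic hζ hN hτN (v := y / 2) (by linarith) le_rfl Q hQm
      (fun z hz => hroots z (Multiset.mem_add.2 (Or.inr hz)))
    have h1 := hnonneg p
    have h2 := hnonneg Q
    rw [Multiset.map_add, Multiset.sum_add]
    rcases hmain with h | h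
    · linarith
    rcases hQ with h' | h'
    · linarith
    · have h12 : (12 : ℚ) ≤ p.natDegree + Q.natDegree := by
        rw [hdegs] at hdeg; exact_mod_cast hdeg
      -- The total is `y` plus the excess of the orbit of `τ` plus at least `y / 2` for each of at
      -- least twelve roots, so at least `7 * y` plus the excess.
      nlinarith

/-- The Reid–Tai sum of the roots of `P`, if some root is not `±1`. -/
theorem one_le_sum_of_root_ne (hK : IsGenericImaginary K) (hζ : IsPrimitiveRoot ζ N)
    (hN : 0 < N) {P : K[X]} (hm : P.Monic) (hroots : ∀ z ∈ P.aroots ℂ, z ^ N = 1)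
    {z : ℂ} (hz : z ∈ P.aroots ℂ) (hz2 : z ^ 2 ≠ 1) :
    1 ≤ ((P.aroots ℂ).map fun z => rootAngle ζ N z).sum := by
  have hz0 : aeval z P = 0 := (mem_aroots.1 hz).2
  have hint : IsIntegral K z := ⟨P, hm, by rwa [aeval_def] at hz0⟩
  obtain ⟨Q, rfl⟩ := minpoly.dvd K z hz0
  have hr0 : 0 < orderOf z :=
    orderOf_pos_iff.2 (isOfFinOrder_iff_pow_eq_one.2 ⟨N, hN, hroots z hz⟩)
  have hrN : orderOf z ∣ N := orderOf_dvd_of_pow_eq_one (hroots z hz)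
  have hz_eval := minpoly.aeval K z
  have hpm : (minpoly K z).Monic := minpoly.monic hint
  have hirr : Irreducible (minpoly K z) := minpoly.irreducible hint
  generalize minpoly K z = p at *
  have hroot : (p * Q).aroots ℂ = p.aroots ℂ + Q.aroots ℂ := aroots_mul hm.ne_zero
  have hR := hK.isHalfSystem hirr hpm hr0 (IsPrimitiveRoot.orderOf z) hz_eval
  have hnonneg : 0 ≤ ((Q.aroots ℂ).map fun z => rootAngle ζ N z).sum :=
    Multiset.sum_nonneg fun x hx => by
      obtain ⟨z, _, rfl⟩ := Multiset.mem_map.1 hx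
      exact IsPrimitiveRoot.rootAngle_nonneg _
  rw [hroot] at hroots ⊢
  rw [Multiset.map_add, Multiset.sum_add]
  suffices h : 1 ≤ ((p.aroots ℂ).map fun z => rootAngle ζ N z).sum by linarith
  have hRN : ∀ w ∈ (p.aroots ℂ).toFinset, w ^ N = 1 := fun w hw =>
    hroots w (Multiset.mem_add.2 (Or.inl (Multiset.mem_toFinset.1 hw)))
  rw [sum_map_aroots hirr]
  have hprod := prod_aroots_mem hirr hpm
  have hsum := sum_aroots_mem hirr hpm
  generalize (p.aroots ℂ).toFinset = R at *
  have hd3 : 3 ≤ orderOf z := by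
    by_contra hlt
    have : orderOf z = 1 ∨ orderOf z = 2 := by omega
    refine hz2 (orderOf_dvd_iff_pow_eq_one.1 ?_)
    rcases this with h | h <;> rw [h] <;> norm_num
  generalize hd : orderOf z = d at *
  by_cases hsp : d = 3 ∨ d = 4 ∨ d = 6 ∨ d = 8 ∨ d = 10 ∨ d = 12
  · obtain ⟨w, hw, hw'⟩ := hK.exists_inv_mem hsp hR hprod hsum
    refine hζ.one_le_sum_of_mem_of_inv_mem hN hw hw' (hRN w hw) ?_
    exact ((mem_primitiveRoots hr0).1 (hR.subset hw)).pow_ne_one_of_pos_of_lt (by norm_num)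
      (by omega)
  · have hlt := hζ.half_lt_sum_of_isHalfSystem hN (by omega) (by omega) (by omega) (by omega)
      hR hrN
    -- Angles are additive modulo integers. The product of the orbit lies in `K`, so it is `±1` and
    -- the angle sum is a half-integer; exceeding `1/2`, it is at least `1`.
    have hmod : ∀ T : Finset ℂ, (∀ w ∈ T, w ^ N = 1) → (∏ w ∈ T, w) ^ N = 1 ∧
        ∃ m : ℤ, rootAngle ζ N (∏ w ∈ T, w) = ∑ w ∈ T, rootAngle ζ N w + m := by
      classical
      intro T
      induction T using Finset.induction_on with
      | empty => intro _; exact ⟨by simp, 0, by simp [hζ.rootAngle_one hN]⟩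
      | insert a T ha ih =>
        intro hT
        obtain ⟨h1, m, hm'⟩ := ih fun w hw => hT w (Finset.mem_insert_of_mem hw)
        have haN := hT a (Finset.mem_insert_self a T)
        obtain ⟨m', hm''⟩ := hζ.rootAngle_mul hN haN h1
        rw [Finset.prod_insert ha, Finset.sum_insert ha]
        exact ⟨by rw [mul_pow, haN, h1, one_mul], m + m', by
          rw [hm'', hm']; push_cast; ring⟩
    obtain ⟨h1, m, hm'⟩ := hmod R hRN
    have h2 : (∏ w ∈ R, w) ^ 2 = 1 := by
      rcases hK.root_of_unity _ hprod N hN h1 with h | h <;> rw [h] <;> norm_num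
    obtain ⟨m', hm''⟩ := hζ.exists_mul_rootAngle_eq hN h1 h2
    rw [hm'] at hm''
    push_cast at hm''
    have h3 : 2 * ∑ w ∈ R, rootAngle ζ N w = ((m' - 2 * m : ℤ) : ℚ) := by
      push_cast; linarith
    rw [h3] at hlt
    have h4 : 1 < m' - 2 * m := by exact_mod_cast hlt
    have h5 : 2 ≤ m' - 2 * m := by omega
    have h6 : (2 : ℚ) ≤ ((m' - 2 * m : ℤ) : ℚ) := by exact_mod_cast h5
    linarith

end IsGenericImaginary

/-! ### Eigenvalues of an element with a quasi-reflection power -/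

namespace IsGenericImaginary

variable {K : IntermediateField ℚ ℂ}

theorem mem_of_aroots_minpoly {z : ℂ} (hz : IsIntegral K z)
    (h : ∀ w, aeval w (minpoly K z) = 0 → w = z) : z ∈ K := by
  have hirr := minpoly.irreducible hz
  have h1 : ((minpoly K z).aroots ℂ).toFinset = {z} := by
    ext w
    rw [Multiset.mem_toFinset, mem_aroots, Finset.mem_singleton]
    constructor
    · exact fun hw => h w hw.2
    · rintro rfl
      exact ⟨hirr.ne_zero, minpoly.aeval K w⟩
  have h2 := sum_aroots_mem hirr (minpoly.monic hz)
  rwa [h1, Finset.sum_singleton] at h2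

/-- If `x` is a root of multiplicity `n ≥ 2` of a polynomial over `K` with only one other root,
counted with multiplicity, then `x ∈ K`. -/
theorem mem_of_aroots_eq_cons_replicate {p : K[X]} (hm : p.Monic) {n : ℕ} (hn : 2 ≤ n) {x y : ℂ}
    (hp : p.aroots ℂ = y ::ₘ Multiset.replicate n x) : x ∈ K := by
  classical
  have hx : x ∈ p.aroots ℂ := by
    rw [hp]
    exact Multiset.mem_cons_of_mem (Multiset.mem_replicate.2 ⟨by omega, rfl⟩)
  have hx0 := (mem_aroots.1 hx).2
  have hint : IsIntegral K x := ⟨p, hm, by rwa [aeval_def] at hx0⟩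
  obtain ⟨q, rfl⟩ := minpoly.dvd K x hx0
  have hirr := minpoly.irreducible hint
  have hpm := minpoly.monic hint
  have hroot : (minpoly K x * q).aroots ℂ = (minpoly K x).aroots ℂ + q.aroots ℂ :=
    aroots_mul hm.ne_zero
  rw [hroot] at hp
  have hsub : ∀ w ∈ (minpoly K x).aroots ℂ, w = x ∨ w = y := fun w hw => by
    have : w ∈ y ::ₘ Multiset.replicate n x := hp ▸ Multiset.mem_add.2 (Or.inl hw)
    rcases Multiset.mem_cons.1 this with h | h
    · exact Or.inr h
    · exact Or.inl (Multiset.eq_of_mem_replicate h)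
  -- If `y` is a conjugate of `x` different from it, the minimal polynomial uses up `y` and one copy
  -- of `x`. The cofactor has only the root `x`, with multiplicity `n - 1 ≥ 1`, and its root sum
  -- puts `x` in `K`. Otherwise `x` is its only conjugate.
  by_cases hxy : y ≠ x ∧ y ∈ (minpoly K x).aroots ℂ
  · have h1 : (minpoly K x).aroots ℂ = y ::ₘ {x} := by
      refine (Multiset.Nodup.ext (nodup_aroots hirr) ?_).2 fun w => ?_
      · simpa using hxy.1
      · rw [Multiset.mem_cons, Multiset.mem_singleton]
        constructor
        · exact fun hw => (hsub w hw).symm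
        · rintro (rfl | rfl)
          · exact hxy.2
          · exact mem_aroots.2 ⟨hirr.ne_zero, minpoly.aeval K w⟩
    obtain ⟨m, rfl⟩ : ∃ m, n = m + 1 := ⟨n - 1, by omega⟩
    rw [h1, Multiset.cons_add, Multiset.cons_inj_right, Multiset.replicate_succ,
      Multiset.singleton_add, Multiset.cons_inj_right] at hp
    have h2 := multiset_sum_aroots_mem (hpm.of_mul_monic_left hm)
    rw [hp, Multiset.sum_replicate, nsmul_eq_mul] at h2
    have h3 : (m : ℂ) ≠ 0 := by
      have : m ≠ 0 := by omega
      exact_mod_cast this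
    have h4 := mul_mem (inv_mem (natCast_mem K m)) h2
    rwa [inv_mul_cancel_left₀ h3] at h4
  · refine mem_of_aroots_minpoly hint fun w hw => ?_
    have hw' : w ∈ (minpoly K x).aroots ℂ := mem_aroots.2 ⟨hirr.ne_zero, hw⟩
    rcases hsub w hw' with h | h
    · exact h
    · subst h
      by_contra hne
      exact hxy ⟨hne, hw'⟩

variable {n : ℕ} {α : ℂ} {c : Fin n → ℂ} {k : ℕ} {j : Fin n}

/-- The eigenvalues of `±g ^ f` on `Λ ⊗ ℂ`, where `g` has the eigenvalue `α` on the line `𝕎` and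
the eigenvalues `c i` on the tangent space. -/
def eigenvalueMultiset (α : ℂ) (c : Fin n → ℂ) (s : ℤ) (f : ℕ) : Multiset ℂ :=
  (s * α ^ f) ::ₘ Finset.univ.val.map fun i => s * (α * c i) ^ f

theorem eigenvalueMultiset_eq_cons (s : ℤ) (f : ℕ) (j : Fin n) :
    eigenvalueMultiset α c s f = (s * (α * c j) ^ f) ::ₘ (s * α ^ f) ::ₘ
      (Finset.univ.erase j).val.map fun i => s * (α * c i) ^ f := by
  classical
  rw [eigenvalueMultiset, Multiset.cons_swap]
  congr 1
  conv_lhs => rw [← Finset.insert_erase (Finset.mem_univ j)]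
  rw [Finset.insert_val_of_notMem (Finset.notMem_erase j _), Multiset.map_cons]

/-- The hypotheses on the eigenvalues of `g`: the powers of `±g` are defined over `K`, and
`g ^ k` is the first power of `g` that is a quasi-reflection. -/
structure EigenvalueData (K : IntermediateField ℚ ℂ) (α : ℂ) (c : Fin n → ℂ) (k : ℕ)
    (j : Fin n) : Prop where
  finite_order : ∃ M, 0 < M ∧ α ^ M = 1 ∧ ∀ i, c i ^ M = 1
  poly : ∀ (s : ℤ) (f : ℕ), ∃ Q : K[X], Q.Monic ∧ Q.aroots ℂ = eigenvalueMultiset α c s f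
  pow_ne : c j ^ k ≠ 1
  pow_eq : ∀ i, i ≠ j → c i ^ k = 1
  minimal : ∀ e, 0 < e → e < k → c j ^ e ≠ 1 → ∃ i, i ≠ j ∧ c i ^ e ≠ 1

namespace EigenvalueData

theorem ne_zero (h : EigenvalueData K α c k j) : α ≠ 0 ∧ ∀ i, c i ≠ 0 := by
  obtain ⟨M, hM, h1, h2⟩ := h.finite_order
  constructor
  · rintro rfl; simp [hM.ne'] at h1
  · intro i h0; have := h2 i; simp [h0, hM.ne'] at this

/-- The power `g ^ k` has the eigenvalue `α ^ k` with multiplicity `n` and one other eigenvalue. The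
repeated one lies in `K`, then so does the other by the trace. Both are therefore `±1`, and they
differ. -/
theorem pow_eigenvalues (hK : IsGenericImaginary K) (hn : 2 ≤ n) (h : EigenvalueData K α c k j) :
    (α ^ k = 1 ∨ α ^ k = -1) ∧ (α * c j) ^ k = -α ^ k := by
  obtain ⟨M, hM, hαM, hcM⟩ := h.finite_order
  obtain ⟨Q, hQm, hQ⟩ := h.poly 1 k
  have hmap : ((Finset.univ.erase j).val.map fun i => ((1 : ℤ) : ℂ) * (α * c i) ^ k) =
      Multiset.replicate (n - 1) (α ^ k) := by
    rw [Multiset.map_congr rfl (g := fun _ => α ^ k), Multiset.map_const', Finset.card_val,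
      Finset.card_erase_of_mem (Finset.mem_univ j), Finset.card_univ, Fintype.card_fin]
    intro i hi
    rw [mul_pow, h.pow_eq i (Finset.ne_of_mem_erase (show i ∈ Finset.univ.erase j from hi))]
    simp
  rw [eigenvalueMultiset_eq_cons 1 k j, hmap, Int.cast_one, one_mul, one_mul,
    ← Multiset.replicate_succ, show n - 1 + 1 = n by omega] at hQ
  have hx : α ^ k ∈ K := mem_of_aroots_eq_cons_replicate hQm hn hQ
  have hy : (α * c j) ^ k ∈ K := by
    have h1 := multiset_sum_aroots_mem hQm
    rw [hQ, Multiset.sum_cons, Multiset.sum_replicate] at h1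
    have h2 := sub_mem h1 (nsmul_mem hx n)
    rwa [add_sub_cancel_right] at h2
  have hx1 := hK.root_of_unity _ hx M hM (by rw [← pow_mul, mul_comm, pow_mul, hαM, one_pow])
  have hy1 := hK.root_of_unity _ hy M hM (by
    rw [← pow_mul, mul_comm k M, pow_mul, mul_pow, hαM, hcM, one_mul, one_pow])
  refine ⟨hx1, ?_⟩
  have hne : (α * c j) ^ k ≠ α ^ k := by
    rw [mul_pow]
    intro he
    exact h.pow_ne (mul_left_cancel₀ (pow_ne_zero k h.ne_zero.1) (by rw [he, mul_one]))
  rcases hx1 with h1 | h1 <;> rcases hy1 with h2 | h2 <;> rw [h1, h2] at hne ⊢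
  · exact absurd rfl hne
  · norm_num
  · exact absurd rfl hne

theorem pow_eq_neg_one (hK : IsGenericImaginary K) (hn : 2 ≤ n) (h : EigenvalueData K α c k j) :
    c j ^ k = -1 := by
  have h1 := (h.pow_eigenvalues hK hn).2
  rw [mul_pow] at h1
  refine mul_left_cancel₀ (pow_ne_zero k h.ne_zero.1) ?_
  rw [h1, mul_neg_one]

/-- A conjugate of `α * c j` is an eigenvalue of `g` with the same `k`-th power, because that power
lies in `K`. All other eigenvalues have `k`-th power `α ^ k`, so `α * c j` has no other conjugate.
-/
theorem exceptional_eigenvalue (hK : IsGenericImaginary K) (hn : 2 ≤ n)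
    (h : EigenvalueData K α c k j) : α * c j ∈ K ∧ (α * c j = 1 ∨ α * c j = -1) := by
  obtain ⟨M, hM, hαM, hcM⟩ := h.finite_order
  obtain ⟨hx, hρ⟩ := h.pow_eigenvalues hK hn
  have hβM : (α * c j) ^ M = 1 := by rw [mul_pow, hαM, hcM, one_mul]
  have hne : α ^ k ≠ (α * c j) ^ k := by
    rw [hρ]
    intro he
    have : α ^ k = 0 := by linear_combination (1 / 2 : ℂ) * he
    exact pow_ne_zero k h.ne_zero.1 this
  have hmem : α * c j ∈ K := by
    have hint : IsIntegral K (α * c j) :=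
      IsIntegral.of_pow hM (by rw [hβM]; exact isIntegral_one)
    refine mem_of_aroots_minpoly hint fun w hw => ?_
    obtain ⟨Q, hQm, hQ⟩ := h.poly 1 1
    have hβQ : α * c j ∈ Q.aroots ℂ := by
      rw [hQ, eigenvalueMultiset_eq_cons 1 1 j]
      simp
    have hwQ : w ∈ Q.aroots ℂ := by
      obtain ⟨s, hs⟩ := minpoly.dvd K _ (mem_aroots.1 hβQ).2
      rw [mem_aroots]
      exact ⟨hQm.ne_zero, by rw [hs, map_mul, hw, zero_mul]⟩
    have hwk : w ^ k = (α * c j) ^ k := by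
      have hρK : (α * c j) ^ k ∈ K := by
        rw [hρ]
        rcases hx with h1 | h1 <;> rw [h1]
        · exact neg_mem (one_mem K)
        · rw [neg_neg]; exact one_mem K
      have h1 : aeval (α * c j) (X ^ k - C (⟨_, hρK⟩ : K)) = 0 := by simp
      obtain ⟨s, hs⟩ := minpoly.dvd K _ h1
      have h2 : aeval w (X ^ k - C (⟨_, hρK⟩ : K)) = 0 := by rw [hs, map_mul, hw, zero_mul]
      rw [map_sub, map_pow, aeval_X, aeval_C, sub_eq_zero] at h2
      exact h2
    rw [hQ, eigenvalueMultiset] at hwQ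
    simp only [Int.cast_one, one_mul, pow_one, Multiset.mem_cons, Multiset.mem_map] at hwQ
    rcases hwQ with rfl | ⟨i, _, rfl⟩
    · exact absurd hwk hne
    · by_cases hij : i = j
      · rw [hij]
      · rw [mul_pow, h.pow_eq i hij, mul_one] at hwk
        exact absurd hwk hne
  exact ⟨hmem, hK.root_of_unity _ hmem M hM hβM⟩

/-- The eigenvalues other than the exceptional one are the roots of a polynomial over `K`. -/
theorem exists_poly_erase (hK : IsGenericImaginary K) (hn : 2 ≤ n)
    (h : EigenvalueData K α c k j) (s : ℤ) (f : ℕ) :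
    ∃ P : K[X], P.Monic ∧ P.aroots ℂ = (s * α ^ f) ::ₘ
      (Finset.univ.erase j).val.map fun i => s * (α * c i) ^ f := by
  obtain ⟨Q, hQm, hQ⟩ := h.poly s f
  rw [eigenvalueMultiset_eq_cons s f j] at hQ
  have hβ : s * (α * c j) ^ f ∈ K :=
    mul_mem (intCast_mem K s) (pow_mem (h.exceptional_eigenvalue hK hn).1 f)
  set b : K := ⟨_, hβ⟩ with hb
  have hroot : (X - C b) ∣ Q := by
    rw [dvd_iff_isRoot, IsRoot]
    have h1 : (s * (α * c j) ^ f : ℂ) ∈ Q.aroots ℂ := by rw [hQ]; exact Multiset.mem_cons_self _ _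
    have h2 := (mem_aroots.1 h1).2
    have h3 : (s * (α * c j) ^ f : ℂ) = algebraMap K ℂ b := rfl
    rw [h3, aeval_algebraMap_apply] at h2
    exact (map_eq_zero _).1 h2
  obtain ⟨P, rfl⟩ := hroot
  refine ⟨P, (monic_X_sub_C b).of_mul_monic_left hQm, ?_⟩
  rw [aroots_mul hQm.ne_zero, aroots_X_sub_C, Multiset.singleton_add] at hQ
  exact (Multiset.cons_inj_right _).1 hQ

/-- This is where the minimality of `k` enters: if all `c i ^ f` were `±1`, then with `e = gcd(f, k)
< k` the power `g ^ e` would act on the tangent space as `g ^ k` does and already be a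
quasi-reflection. -/
theorem exists_sq_ne_one (h : EigenvalueData K α c k j)
    (hneg : c j ^ k = -1) {f : ℕ} (hf : 1 ≤ f) (hfk : f < k) (hj : c j ^ (2 * f) = 1) :
    ∃ i, i ≠ j ∧ (c i ^ f) ^ 2 ≠ 1 := by
  by_contra! hall
  have h1 : ∀ i, c i ^ (2 * Nat.gcd f k) = 1 := by
    intro i
    rw [← Nat.gcd_mul_left]
    refine pow_gcd_eq_one.2 ?_
    by_cases hij : i = j
    · subst hij
      exact ⟨hj, by rw [mul_comm, pow_mul, hneg]; norm_num⟩
    · exact ⟨by rw [mul_comm, pow_mul]; exact hall i hij,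
        by rw [mul_comm, pow_mul, h.pow_eq i hij, one_pow]⟩
  obtain ⟨q, hq⟩ := Nat.gcd_dvd_right f k
  have he : 0 < Nat.gcd f k := Nat.gcd_pos_of_pos_left k hf
  have hek : Nat.gcd f k < k := (Nat.le_of_dvd hf (Nat.gcd_dvd_left f k)).trans_lt hfk
  generalize Nat.gcd f k = e at *
  -- For even `k / e` the relation `c j ^ (2 * e) = 1` would give `c j ^ k = 1`.
  have hqodd : q % 2 = 1 := by
    by_contra hq2
    obtain ⟨t, rfl⟩ : ∃ t, q = 2 * t := ⟨q / 2, by omega⟩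
    refine h.pow_ne ?_
    rw [hq, show e * (2 * t) = 2 * e * t by ring, pow_mul, h1, one_pow]
  have h2 : ∀ i, c i ^ e = c i ^ k := by
    intro i
    obtain ⟨t, rfl⟩ : ∃ t, q = 2 * t + 1 := ⟨q / 2, by omega⟩
    rw [hq, show e * (2 * t + 1) = 2 * e * t + e by ring, pow_add, pow_mul, h1, one_pow, one_mul]
  obtain ⟨i, hij, hi⟩ := h.minimal e he hek (by rw [h2]; exact h.pow_ne)
  exact hi (by rw [h2, h.pow_eq i hij])

/-- The modified Reid–Tai inequality in terms of angles. -/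
theorem one_le_sum_rootAngle (hK : IsGenericImaginary K) (hn : 12 ≤ n) (hk : 0 < k)
    (h : EigenvalueData K α c k j) {ζ : ℂ} (hζ : IsPrimitiveRoot ζ (2 * k)) {f : ℕ}
    (hf : 1 ≤ f) (hfk : f < k) :
    1 ≤ rootAngle ζ (2 * k) (c j ^ (2 * f)) +
      ∑ i ∈ Finset.univ.erase j, rootAngle ζ (2 * k) (c i ^ f) := by
  have hN : 0 < 2 * k := by omega
  have hneg := h.pow_eq_neg_one hK (by omega)
  have hα0 := h.ne_zero.1
  have hc0 := h.ne_zero.2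
  have hcN : ∀ i, c i ^ (2 * k) = 1 := fun i => by
    by_cases hij : i = j
    · rw [hij, mul_comm, pow_mul, hneg]; norm_num
    · rw [mul_comm, pow_mul, h.pow_eq i hij, one_pow]
  have hβ2 : (α * c j) ^ 2 = 1 := by
    rcases (h.exceptional_eigenvalue hK (by omega)).2 with h1 | h1 <;> rw [h1] <;> norm_num
  have hαN : α ^ (2 * k) = 1 := by
    have h1 : (α * c j) ^ (2 * k) = 1 := by rw [pow_mul, hβ2, one_pow]
    rwa [mul_pow, hcN, mul_one] at h1
  have hα2 : α ^ (2 * f) * c j ^ (2 * f) = 1 := by rw [← mul_pow, pow_mul, hβ2, one_pow]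
  have hnonneg := IsPrimitiveRoot.rootAngle_nonneg (ζ := ζ) (N := 2 * k)
  by_cases hτ : (α ^ f) ^ 2 = 1
  · have hj : c j ^ (2 * f) = 1 := by
      rwa [mul_comm 2 f, pow_mul α, hτ, one_mul, mul_comm f 2] at hα2
    obtain ⟨i, hij, hi⟩ := h.exists_sq_ne_one hneg hf hfk hj
    -- Multiplying `g ^ f` by the sign `s = α ^ f` turns its eigenvalues `(α * c i) ^ f` into `c i ^
    -- f`, so these are roots of a polynomial over `K`, together with an extra root `1` of angle
    -- zero.
    obtain ⟨s, hs⟩ : ∃ s : ℤ, (s : ℂ) = α ^ f := by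
      rcases sq_eq_sq_iff_eq_or_eq_neg.1 (hτ.trans (one_pow 2).symm) with h1 | h1
      · exact ⟨1, by rw [h1]; simp⟩
      · exact ⟨-1, by rw [h1]; simp⟩
    obtain ⟨P, hPm, hP⟩ := h.exists_poly_erase hK (by omega) s f
    have hfun : (fun i => (s : ℂ) * (α * c i) ^ f) = fun i => c i ^ f := by
      funext i
      rw [hs, mul_pow, ← mul_assoc, ← sq, hτ, one_mul]
    rw [hfun, hs, ← sq, hτ] at hP
    have key := hK.one_le_sum_of_root_ne hζ hN hPm (fun z hz => by
      rw [hP] at hz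
      rcases Multiset.mem_cons.1 hz with rfl | hz
      · exact one_pow _
      · obtain ⟨i, _, rfl⟩ := Multiset.mem_map.1 hz
        rw [← pow_mul, mul_comm, pow_mul, hcN, one_pow]) (z := c i ^ f) (by
      rw [hP]
      exact Multiset.mem_cons_of_mem (Multiset.mem_map.2
        ⟨i, Finset.mem_erase.2 ⟨hij, Finset.mem_univ i⟩, rfl⟩)) hi
    rw [hP, Multiset.map_cons, Multiset.sum_cons, hζ.rootAngle_one hN, zero_add,
      Multiset.map_map] at key
    exact key.trans (le_add_of_nonneg_left (hnonneg _))
  · obtain ⟨P, hPm, hP⟩ := h.exists_poly_erase hK (by omega) 1 f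
    simp only [Int.cast_one, one_mul] at hP
    have hroots : ∀ z ∈ P.aroots ℂ, z ^ (2 * k) = 1 := fun z hz => by
      rw [hP] at hz
      rcases Multiset.mem_cons.1 hz with rfl | hz
      · rw [← pow_mul, mul_comm, pow_mul, hαN, one_pow]
      · obtain ⟨i, _, rfl⟩ := Multiset.mem_map.1 hz
        rw [← pow_mul, mul_comm f, pow_mul, mul_pow, hαN, hcN, one_mul, one_pow]
    have hdeg : P.natDegree = n := by
      rw [← natDegree_map (algebraMap K ℂ), ← splits_iff_card_roots.1 (IsAlgClosed.splits _)]
      change Multiset.card (P.aroots ℂ) = n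
      rw [hP, Multiset.card_cons, Multiset.card_map, Finset.card_val,
        Finset.card_erase_of_mem (Finset.mem_univ j), Finset.card_univ, Fintype.card_fin]
      omega
    -- Relative to `τ = α ^ f` the root `τ` has angle zero, the other roots become `c i ^ f`, and
    -- `τ⁻² = c j ^ (2 * f)` because `α * c j = ±1`.
    have key := hK.one_le_sum_of_root hζ hN hPm hroots (by omega) (τ := α ^ f)
      (by rw [hP]; exact Multiset.mem_cons_self _ _) hτ
    have hα0' := pow_ne_zero f hα0
    have e1 : (α ^ f)⁻¹ * (α ^ f)⁻¹ = c j ^ (2 * f) := by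
      field_simp
      rw [← hα2]; ring
    rw [hP, Multiset.map_cons, Multiset.sum_cons, mul_inv_cancel₀ hα0', hζ.rootAngle_one hN,
      zero_add, Multiset.map_map, e1] at key
    refine key.trans_eq ?_
    congr 1
    refine congrArg Multiset.sum (Multiset.map_congr rfl fun i _ => ?_)
    rw [Function.comp_apply, mul_pow]
    field_simp

end EigenvalueData

end IsGenericImaginary

/-! ### Diagonalisable maps -/

section Diagonal

variable {V : Type*} [AddCommGroup V] [Module ℂ V]

/-- An endomorphism of finite order has a basis of eigenvectors that starts with a given
eigenvector. -/
theorem Module.End.exists_eigenbasis_of_pow_eq_one [FiniteDimensional ℂ V] {T : Module.End ℂ V}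
    {M : ℕ} (hM : 0 < M) (hT : T ^ M = 1) {n : ℕ} (hn : Module.finrank ℂ V = n + 1) {ω : V}
    (hω : ω ≠ 0) {α : ℂ} (hα : T ω = α • ω) :
    ∃ (b : Module.Basis (Fin (n + 1)) ℂ V) (μ : Fin (n + 1) → ℂ),
      b 0 = ω ∧ ∀ i, T (b i) = μ i • b i := by
  have hss : T.IsSemisimple := by
    refine Module.End.isSemisimple_of_squarefree_aeval_eq_zero (p := X ^ M - 1) ?_ (by simp [hT])
    exact (X_pow_sub_one_separable_iff.2 (by exact_mod_cast hM.ne')).squarefree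
  set t : Set V := {v | ∃ μ : ℂ, T v = μ • v} with ht
  have hspan : ⊤ ≤ Submodule.span ℂ t := by
    rw [← hss.iSup_eigenspace_eq_top]
    exact iSup_le fun μ v hv => Submodule.subset_span ⟨μ, Module.End.mem_eigenspace_iff.1 hv⟩
  have hli : LinearIndepOn ℂ id ({ω} : Set V) := LinearIndepOn.singleton hω
  have hst : ({ω} : Set V) ⊆ t := by
    rintro _ rfl; exact ⟨α, hα⟩
  set b := Module.Basis.extendLe hli hst hspan with hb
  have hωb : ω ∈ hli.extend hst := hli.subset_extend hst rfl
  have hbv : ∀ i, b i = (i : V) := fun i => Module.Basis.extendLe_apply_self hli hst hspan i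
  have : Fintype (hli.extend hst) := FiniteDimensional.fintypeBasisIndex b
  have hcard : Fintype.card (hli.extend hst) = n + 1 := by
    rw [← hn, Module.finrank_eq_card_basis b]
  let e₀ : hli.extend hst ≃ Fin (n + 1) := Fintype.equivFinOfCardEq hcard
  -- The transposition moves the prescribed vector `ω` to index `0`.
  let e : hli.extend hst ≃ Fin (n + 1) := e₀.trans (Equiv.swap (e₀ ⟨ω, hωb⟩) 0)
  have he : e.symm 0 = ⟨ω, hωb⟩ := by
    rw [Equiv.symm_apply_eq]
    simp [e]
  have heig : ∀ i, ∃ μ : ℂ, T (b.reindex e i) = μ • b.reindex e i := fun i => by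
    rw [Module.Basis.reindex_apply, hbv]
    exact hli.extend_subset hst (e.symm i).2
  choose μ hμ using heig
  exact ⟨b.reindex e, μ, by rw [Module.Basis.reindex_apply, he, hbv], hμ⟩

variable {ι : Type*} {b : Module.Basis ι ℂ V} {c : ι → ℂ}

theorem LinearMap.toMatrix_eq_diagonal [Fintype ι] [DecidableEq ι] {T : V →ₗ[ℂ] V} (h : ∀ i, T (b i) = c i • b i) :
    LinearMap.toMatrix b b T = Matrix.diagonal c := by
  ext i j
  rw [LinearMap.toMatrix_apply, h, map_smul, Finsupp.smul_apply, Module.Basis.repr_self,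
    Matrix.diagonal_apply, Finsupp.single_apply]
  by_cases hij : i = j
  · simp [hij]
  · simp [hij, Ne.symm hij]

theorem LinearMap.roots_charpoly_of_eigenbasis [Fintype ι] [DecidableEq ι] [Module.Finite ℂ V] {T : V →ₗ[ℂ] V}
    (h : ∀ i, T (b i) = c i • b i) : T.charpoly.roots = Finset.univ.val.map c := by
  rw [← LinearMap.charpoly_toMatrix T b, LinearMap.toMatrix_eq_diagonal h, Matrix.charpoly,
    Matrix.charmatrix_diagonal, Matrix.det_diagonal]
  have : (∏ i, (X - C (c i))) = ((Finset.univ.val.map c).map fun a => X - C a).prod := by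
    rw [Multiset.map_map]; rfl
  rw [this, roots_multiset_prod_X_sub_C]

theorem LinearMap.finrank_range_of_eigenbasis [Fintype ι] [DecidableEq ι] {T : V →ₗ[ℂ] V}
    (h : ∀ i, T (b i) = c i • b i) :
    Module.finrank ℂ (LinearMap.range T) = (Finset.univ.filter fun i => c i ≠ 0).card := by
  classical
  have h1 := Matrix.rank_eq_finrank_range_toLin (LinearMap.toMatrix b b T) b b
  rw [Matrix.toLin_toMatrix] at h1
  rw [← h1, LinearMap.toMatrix_eq_diagonal h, Matrix.rank_diagonal, Fintype.card_subtype]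

theorem BallQuotient.isQuasiReflection_iff_of_eigenbasis [Fintype ι] [DecidableEq ι] {A : V ≃ₗ[ℂ] V}
    (h : ∀ i, A (b i) = c i • b i) :
    BallQuotient.IsQuasiReflection A ↔ ∃ j, c j ≠ 1 ∧ ∀ i, i ≠ j → c i = 1 := by
  have h1 : ∀ i, (A.toLinearMap - LinearMap.id : V →ₗ[ℂ] V) (b i) = (c i - 1) • b i := fun i => by
    rw [LinearMap.sub_apply, LinearEquiv.coe_coe, h, LinearMap.id_apply, sub_smul, one_smul]
  rw [BallQuotient.IsQuasiReflection, LinearMap.finrank_range_of_eigenbasis h1,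
    Finset.card_eq_one]
  simp only [sub_ne_zero]
  constructor
  · rintro ⟨j, hj⟩
    refine ⟨j, ?_, fun i hi => ?_⟩
    · have : j ∈ Finset.univ.filter fun i => c i ≠ 1 := by rw [hj]; simp
      exact (Finset.mem_filter.1 this).2
    · by_contra hne
      have : i ∈ Finset.univ.filter fun i => c i ≠ 1 := by simp [hne]
      rw [hj, Finset.mem_singleton] at this
      exact hi this
  · rintro ⟨j, hj, h2⟩
    refine ⟨j, ?_⟩
    ext i
    rw [Finset.mem_filter, Finset.mem_singleton]
    constructor
    · intro hi
      by_contra hne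
      exact hi.2 (h2 i hne)
    · rintro rfl
      exact ⟨Finset.mem_univ _, hj⟩

theorem LinearEquiv.pow_eq_one_iff_of_eigenbasis {A : V ≃ₗ[ℂ] V} (h : ∀ i, A (b i) = c i • b i)
    (m : ℕ) : A ^ m = 1 ↔ ∀ i, c i ^ m = 1 := by
  have hpow : ∀ i, (A ^ m) (b i) = c i ^ m • b i := by
    induction m with
    | zero => intro i; simp
    | succ m ih =>
      intro i
      rw [pow_succ, LinearEquiv.mul_apply, h, map_smul, ih, smul_smul, pow_succ, mul_comm]
  constructor
  · intro hA i
    have h1 := hpow i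
    rw [hA, LinearEquiv.coe_one, id] at h1
    have h2 : (c i ^ m - 1) • b i = 0 := by rw [sub_smul, one_smul, ← h1, sub_self]
    exact sub_eq_zero.1 ((smul_eq_zero.1 h2).resolve_right (b.ne_zero i))
  · intro hc
    refine LinearEquiv.toLinearMap_injective (b.ext fun i => ?_)
    rw [LinearEquiv.coe_coe, hpow, hc, one_smul]
    rfl

end Diagonal

/-! ### Eigenvalues on the tangent space -/

namespace BallQuotient

variable {D : ℤ} {n : ℕ} {Λ : Type*} [AddCommGroup Λ] [Module (Order D) Λ]

theorem complexify_mul (a b : Λ ≃ₗ[Order D] Λ) (x : Complexified D Λ) :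
    complexify (a * b) x = complexify a (complexify b x) :=
  LinearMap.congr_fun (LinearMap.baseChange_comp (A := ℂ) b.toLinearMap a.toLinearMap) x

theorem complexify_one (x : Complexified D Λ) : complexify (1 : Λ ≃ₗ[Order D] Λ) x = x :=
  LinearMap.congr_fun (LinearMap.baseChange_id (A := ℂ) (R := Order D) (M := Λ)) x

theorem complexify_tmul (a : Λ ≃ₗ[Order D] Λ) (z : ℂ) (x : Λ) :
    complexify a (z ⊗ₜ[Order D] x) = z ⊗ₜ[Order D] a x := rfl

theorem complexify_pow (a : Λ ≃ₗ[Order D] Λ) (m : ℕ) :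
    ((complexify a).toLinearMap : Module.End ℂ (Complexified D Λ)) ^ m =
      (complexify (a ^ m)).toLinearMap := by
  induction m with
  | zero => ext x; simp [complexify_one]
  | succ m ih =>
    refine LinearMap.ext fun x => ?_
    rw [pow_succ, ih, pow_succ]
    exact (complexify_mul _ _ x).symm

theorem complexify_pow_apply_of_eigen (a : Λ ≃ₗ[Order D] Λ) {x : Complexified D Λ} {μ : ℂ}
    (hx : complexify a x = μ • x) (m : ℕ) : complexify (a ^ m) x = μ ^ m • x := by
  induction m with
  | zero => simp [complexify_one]
  | succ m ih => rw [pow_succ, complexify_mul, hx, map_smul, ih, smul_smul, pow_succ, mul_comm]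

/-- The tangent vectors `ω ↦ v` form a basis of the tangent space, and an automorphism acts
diagonally on it. -/
theorem exists_tangent_eigenbasis {p : ℙ ℂ (Complexified D Λ)}
    (b : Module.Basis (Fin (n + 1)) ℂ (Complexified D Λ)) (hb : b 0 = p.rep) :
    ∃ φ : Module.Basis (Fin n) ℂ (TangentSpace p),
      ∀ {h : HermitianStructure D n Λ} {Γ : Subgroup (unitaryGroup h)}
        (g : pointStabilizer Γ p) (μ : Fin (n + 1) → ℂ),
        (∀ i, μ i ≠ 0) →
        (∀ i, complexify ((g : unitaryGroup h) : Λ ≃ₗ[Order D] Λ) (b i) = μ i • b i) →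
        ∀ i, tangentAction g (φ i) = (μ i.succ / μ 0) • φ i := by
  have hW : p.submodule = Submodule.span ℂ {b 0} := by rw [hb, Projectivization.submodule_eq]
  have hfin : Module.Finite ℂ (Complexified D Λ) := Module.Finite.of_basis b
  have hmem : b 0 ∈ p.submodule := by rw [hW]; exact Submodule.mem_span_singleton_self _
  let v : Fin n → TangentSpace p := fun i =>
    ((b.coord 0).comp p.submodule.subtype).smulRight (p.submodule.mkQ (b i.succ))
  have hv : ∀ (i : Fin n) (t : ℂ) (ht : t • b 0 ∈ p.submodule),
      v i ⟨t • b 0, ht⟩ = t • p.submodule.mkQ (b i.succ) := by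
    intro i t ht
    simp [v]
  have hker : ∀ i : Fin n, p.submodule ≤ LinearMap.ker (b.coord i.succ) := by
    intro i
    rw [hW, Submodule.span_singleton_le_iff_mem, LinearMap.mem_ker, Module.Basis.coord_apply,
      Module.Basis.repr_self, Finsupp.single_apply, if_neg (Fin.succ_ne_zero i).symm]
  have hli : LinearIndependent ℂ v := by
    rw [Fintype.linearIndependent_iff]
    intro d hd i
    have h1 := congrArg (fun f : TangentSpace p =>
      p.submodule.liftQ (b.coord i.succ) (hker i) (f ⟨b 0, hmem⟩)) hd
    have h2 : ∀ k, v k ⟨b 0, hmem⟩ = p.submodule.mkQ (b k.succ) := by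
      intro k; simp [v]
    simp only [LinearMap.sum_apply, LinearMap.smul_apply, h2, map_sum, map_smul,
      LinearMap.zero_apply, map_zero, Submodule.mkQ_apply, Submodule.liftQ_apply,
      Module.Basis.coord_apply, Module.Basis.repr_self, Finsupp.single_apply, Fin.succ_inj,
      smul_eq_mul, mul_ite, mul_one, mul_zero, Finset.sum_ite_eq',
      Finset.mem_univ, if_true] at h1
    exact h1
  have hcard : Fintype.card (Fin n) = Module.finrank ℂ (TangentSpace p) := by
    rw [Module.finrank_linearMap, Projectivization.finrank_submodule, one_mul,
      Submodule.finrank_quotient, Projectivization.finrank_submodule,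
      Module.finrank_eq_card_basis b, Fintype.card_fin, Fintype.card_fin]
    rfl
  refine ⟨basisOfLinearIndependentOfCardEqFinrank' v hli hcard, ?_⟩
  intro h Γ g μ hμ0 hμ i
  rw [coe_basisOfLinearIndependentOfCardEqFinrank']
  refine LinearMap.ext fun w => ?_
  set e₁ := (complexify ((g : unitaryGroup h) : Λ ≃ₗ[Order D] Λ)).ofSubmodules p.submodule
    p.submodule g.2.2 with he₁
  obtain ⟨u, rfl⟩ := e₁.surjective w
  obtain ⟨u, hu⟩ := u
  obtain ⟨t, rfl⟩ := Submodule.mem_span_singleton.1 (hW ▸ hu)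
  have h1 : tangentAction g (v i) (e₁ ⟨t • b 0, hu⟩) =
      Submodule.Quotient.equiv p.submodule p.submodule
        (complexify ((g : unitaryGroup h) : Λ ≃ₗ[Order D] Λ)) g.2.2 (v i ⟨t • b 0, hu⟩) := by
    rw [tangentAction, LinearEquiv.arrowCongr_apply, ← he₁, LinearEquiv.symm_apply_apply]
  have h2 : e₁ ⟨t • b 0, hu⟩ = ⟨(t * μ 0) • b 0, Submodule.smul_mem _ _ hmem⟩ := by
    apply Subtype.ext
    change complexify ((g : unitaryGroup h) : Λ ≃ₗ[Order D] Λ) (t • b 0) = _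
    rw [map_smul, hμ, smul_smul]
  rw [h1, hv, h2, LinearMap.smul_apply, hv, map_smul, smul_smul]
  have h3 : Submodule.Quotient.equiv p.submodule p.submodule
      (complexify ((g : unitaryGroup h) : Λ ≃ₗ[Order D] Λ)) g.2.2 (p.submodule.mkQ (b i.succ)) =
      μ i.succ • p.submodule.mkQ (b i.succ) := by
    rw [← map_smul, ← hμ]
    rfl
  rw [h3, smul_smul]
  congr 1
  field_simp [hμ0 0]

end BallQuotient

namespace BallQuotient

variable {D : ℤ} {n : ℕ} {Λ : Type*} [AddCommGroup Λ] [Module (Order D) Λ]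

/-! ### Bounded sets of integers of `ℚ(√D)` -/

theorem numberField_quadField (hD : D < 0) : NumberField (QuadField D) where
  to_charZero := inferInstance
  to_finiteDimensional := by
    refine IntermediateField.adjoin.finiteDimensional (K := ℚ) (x := sqrtGen D) ?_
    refine IsIntegral.of_pow (n := 2) (by norm_num) ?_
    rw [sqrtGen_sq hD]
    simpa using isIntegral_algebraMap (R := ℚ) (A := ℂ) (x := (D : ℚ))

/-- Any embedding sends `√D` to `±√D`, so it agrees with the inclusion up to complex conjugation.
Hence a bound on an algebraic integer in `ℂ` bounds all its conjugates, and only finitely many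
satisfy it. -/
theorem norm_embedding_quadField (hD : D < 0) (φ : QuadField D →+* ℂ) (x : QuadField D) :
    ‖φ x‖ = ‖(x : ℂ)‖ := by
  obtain ⟨a, b, hab⟩ := (mem_quadField_iff hD).1 x.2
  set δ : QuadField D := ⟨sqrtGen D, sqrtGen_mem D⟩ with hδ
  have hx : x = (a : QuadField D) + b * δ := by
    apply Subtype.ext
    rw [hab]
    push_cast
    rfl
  have h1 : φ δ ^ 2 = sqrtGen D ^ 2 := by
    have h2 : δ ^ 2 = (D : QuadField D) := by
      apply Subtype.ext
      push_cast
      exact sqrtGen_sq hD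
    rw [← map_pow, h2, map_intCast, sqrtGen_sq hD]
  have h3 : φ x = a + b * φ δ := by rw [hx]; simp
  rcases sq_eq_sq_iff_eq_or_eq_neg.1 h1 with h | h
  · rw [h3, h, hab]
  · rw [h3, h, hab, ← Complex.norm_conj ((a : ℂ) + b * sqrtGen D), map_add, map_mul, conj_sqrtGen]
    simp

theorem finite_setOf_norm_le (hD : D < 0) (B : ℝ) :
    {x : Order D | ‖algebraMap (Order D) ℂ x‖ ≤ B}.Finite := by
  have := numberField_quadField hD
  have h := NumberField.Embeddings.finite_of_norm_le (QuadField D) ℂ B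
  refine (h.preimage (f := fun x : Order D => (x : QuadField D))
    (fun x _ y _ hxy => NumberField.RingOfIntegers.ext hxy)).subset ?_
  intro x hx
  refine ⟨x.2, fun φ => ?_⟩
  rw [norm_embedding_quadField hD]
  exact hx

/-! ### The hermitian form -/

section Form

variable (h : HermitianStructure D n Λ)

theorem form_complexify {g : Λ ≃ₗ[Order D] Λ} (hg : g ∈ unitaryGroup h)
    (x y : Complexified D Λ) : h.form (complexify g x) (complexify g y) = h.form x y := by
  have htmul : ∀ (z : ℂ) (v : Λ), z ⊗ₜ[Order D] v = z • ((1 : ℂ) ⊗ₜ[Order D] v) := fun z v => by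
    rw [TensorProduct.smul_tmul', smul_eq_mul, mul_one]
  induction x using TensorProduct.induction_on with
  | zero => simp
  | add x x' hx hx' => rw [map_add, map_add, map_add, LinearMap.add_apply, LinearMap.add_apply, hx, hx']
  | tmul z v =>
    induction y using TensorProduct.induction_on with
    | zero => simp
    | add y y' hy hy' => rw [map_add, map_add, map_add, hy, hy']
    | tmul w u =>
      rw [htmul z v, htmul w u]
      simp only [map_smul, map_smulₛₗ, LinearMap.smul_apply, complexify_tmul]
      rw [hg v u]

theorem form_eq_sum {b : Module.Basis (Fin (n + 1)) ℂ (Complexified D Λ)}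
    (hb : ∀ i j, h.form (b i) (b j) = if i = j then (if i = Fin.last n then -1 else 1) else 0)
    (x y : Complexified D Λ) : h.form x y = ∑ i : Fin n, conj (b.repr x i.castSucc) *
      b.repr y i.castSucc - conj (b.repr x (Fin.last n)) * b.repr y (Fin.last n) := by
  have h1 : h.form x y = ∑ i, ∑ j, conj (b.repr x i) * (b.repr y j * h.form (b i) (b j)) := by
    conv_lhs => rw [← b.sum_repr x, ← b.sum_repr y]
    simp only [map_sum, LinearMap.sum_apply, map_smulₛₗ, LinearMap.smul_apply,
      smul_eq_mul, Finset.mul_sum, RingHom.id_apply]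
    rw [Finset.sum_comm]
    refine Finset.sum_congr rfl fun i _ => Finset.sum_congr rfl fun j _ => by ring
  rw [h1]
  simp only [hb, mul_ite, mul_zero, Finset.sum_ite_eq, Finset.mem_univ, if_true]
  rw [Fin.sum_univ_castSucc, if_pos rfl]
  simp only [(Fin.castSucc_lt_last _).ne, if_false, mul_one]
  ring

/-- On the orthogonal complement of a negative vector, the Lorentzian coordinates are bounded by
the form. -/
theorem norm_repr_le_of_orthogonal {b : Module.Basis (Fin (n + 1)) ℂ (Complexified D Λ)}
    (hb : ∀ i j, h.form (b i) (b j) = if i = j then (if i = Fin.last n then -1 else 1) else 0)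
    {ω : Complexified D Λ} (hω : (h.form ω ω).re < 0) (C : ℝ) :
    ∃ B, ∀ v, h.form ω v = 0 → (h.form v v).re = C → ∀ i, ‖b.repr v i‖ ≤ B := by
  set a : ℝ := ∑ i : Fin n, ‖b.repr ω i.castSucc‖ ^ 2 with ha
  set W : ℝ := ‖b.repr ω (Fin.last n)‖ ^ 2 with hW
  have hre : ∀ v, (h.form v v).re =
      ∑ i : Fin n, ‖b.repr v i.castSucc‖ ^ 2 - ‖b.repr v (Fin.last n)‖ ^ 2 := by
    intro v
    rw [form_eq_sum h hb]
    simp only [Complex.conj_mul', ← Complex.ofReal_pow, ← Complex.ofReal_sum, ← Complex.ofReal_sub,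
      Complex.ofReal_re]
  have haW : a < W := by rw [hre] at hω; linarith
  have ha0 : 0 ≤ a := Finset.sum_nonneg fun i _ => by positivity
  -- The two large terms bound `S` and `T = S - C`; the `1` comes from `x ≤ 1 + x ^ 2`.
  refine ⟨1 + (W * C / (W - a) + (W * C / (W - a) - C)), fun v hv hvC i => ?_⟩
  set S : ℝ := ∑ i : Fin n, ‖b.repr v i.castSucc‖ ^ 2 with hS
  set T : ℝ := ‖b.repr v (Fin.last n)‖ ^ 2 with hT
  have hS0 : 0 ≤ S := Finset.sum_nonneg fun i _ => by positivity
  have hT0 : 0 ≤ T := by positivity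
  have hSTC : S - T = C := by rw [← hvC, hre]
  -- Cauchy–Schwarz applied to the orthogonality relation. With `S - T = C` and `a < W` it bounds
  -- `S`.
  have hCS : W * T ≤ a * S := by
    rw [form_eq_sum h hb, sub_eq_zero] at hv
    have h1 : ‖b.repr ω (Fin.last n)‖ * ‖b.repr v (Fin.last n)‖ ≤
        ∑ i : Fin n, ‖b.repr ω i.castSucc‖ * ‖b.repr v i.castSucc‖ := by
      calc ‖b.repr ω (Fin.last n)‖ * ‖b.repr v (Fin.last n)‖
          = ‖conj (b.repr ω (Fin.last n)) * b.repr v (Fin.last n)‖ := by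
            rw [norm_mul, Complex.norm_conj]
        _ = ‖∑ i : Fin n, conj (b.repr ω i.castSucc) * b.repr v i.castSucc‖ := by rw [hv]
        _ ≤ ∑ i : Fin n, ‖conj (b.repr ω i.castSucc) * b.repr v i.castSucc‖ := norm_sum_le _ _
        _ = _ := by simp only [norm_mul, Complex.norm_conj]
    have h2 := Finset.sum_mul_sq_le_sq_mul_sq Finset.univ
      (fun i : Fin n => ‖b.repr ω i.castSucc‖) (fun i => ‖b.repr v i.castSucc‖)
    calc W * T = (‖b.repr ω (Fin.last n)‖ * ‖b.repr v (Fin.last n)‖) ^ 2 := by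
          rw [mul_pow]
      _ ≤ _ := pow_le_pow_left₀ (by positivity) h1 2
      _ ≤ a * S := h2
  have hSle : S ≤ W * C / (W - a) := by
    rw [le_div_iff₀ (by linarith)]
    nlinarith
  have hi : ‖b.repr v i‖ ^ 2 ≤ S + T := by
    refine Fin.lastCases ?_ (fun i => ?_) i
    · linarith
    · have := Finset.single_le_sum (f := fun i : Fin n => ‖b.repr v i.castSucc‖ ^ 2)
        (fun i _ => by positivity) (Finset.mem_univ i)
      linarith
  have h3 : ‖b.repr v i‖ ≤ 1 + ‖b.repr v i‖ ^ 2 := by nlinarith [norm_nonneg (b.repr v i)]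
  linarith

/-- The orbit of a vector under an isometry that fixes a negative line is bounded. -/
theorem exists_bound_orbit {b : Module.Basis (Fin (n + 1)) ℂ (Complexified D Λ)}
    (hb : ∀ i j, h.form (b i) (b j) = if i = j then (if i = Fin.last n then -1 else 1) else 0)
    {g : Λ ≃ₗ[Order D] Λ} (hg : g ∈ unitaryGroup h)
    {ω : Complexified D Λ} (hω : (h.form ω ω).re < 0) {α : ℂ} (hα : complexify g ω = α • ω)
    (x : Complexified D Λ) :
    ∃ B, ∀ (m : ℕ) (i : Fin (n + 1)), ‖b.repr (complexify (g ^ m) x) i‖ ≤ B := by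
  have hω0 : h.form ω ω ≠ 0 := fun h0 => by rw [h0] at hω; simp at hω
  have hα1 : ‖α‖ = 1 := by
    have h1 := form_complexify h hg ω ω
    rw [hα, map_smul, map_smulₛₗ, LinearMap.smul_apply, smul_eq_mul, smul_eq_mul, ← mul_assoc,
      mul_comm α, Complex.conj_mul'] at h1
    have h2 : ((‖α‖ ^ 2 : ℝ) : ℂ) = 1 := by
      push_cast
      exact mul_right_cancel₀ hω0 (by rw [h1, one_mul])
    have h3 : ‖α‖ ^ 2 = 1 := by exact_mod_cast h2
    exact (pow_eq_one_iff_of_nonneg (norm_nonneg α) two_ne_zero).1 h3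
  -- Split `x` into its component along `ω`, which is only rotated because `|α| = 1`, and an
  -- orthogonal component, whose images stay orthogonal to `ω` with constant norm.
  set t : ℂ := h.form ω x / h.form ω ω with ht
  set v : Complexified D Λ := x - t • ω with hv
  have hωv : h.form ω v = 0 := by
    rw [hv, map_sub, map_smul, smul_eq_mul, ht, div_mul_cancel₀ _ hω0, sub_self]
  obtain ⟨B, hB⟩ := norm_repr_le_of_orthogonal h hb hω (h.form v v).re
  refine ⟨‖t‖ * ∑ i, ‖b.repr ω i‖ + B, fun m i => ?_⟩
  have hgm : g ^ m ∈ unitaryGroup h := pow_mem hg m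
  have hgω := complexify_pow_apply_of_eigen g hα m
  have hα0 : α ^ m ≠ 0 := pow_ne_zero m (fun h0 => by rw [h0] at hα1; simp at hα1)
  have h1 : h.form ω (complexify (g ^ m) v) = 0 := by
    have h2 := form_complexify h hgm ω v
    rw [hωv, hgω, map_smulₛₗ, LinearMap.smul_apply, smul_eq_mul] at h2
    exact (mul_eq_zero.1 h2).resolve_left (by simpa using hα0)
  have h3 := hB _ h1 (by rw [form_complexify h hgm]) i
  have hx : x = t • ω + v := by rw [hv]; abel
  have h4 : b.repr (complexify (g ^ m) x) i =
      t * (α ^ m * b.repr ω i) + b.repr (complexify (g ^ m) v) i := by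
    conv_lhs => rw [hx, map_add, map_smul, hgω]
    simp
  rw [h4]
  refine (norm_add_le _ _).trans (add_le_add ?_ h3)
  rw [norm_mul, norm_mul, norm_pow, hα1, one_pow, one_mul]
  exact mul_le_mul_of_nonneg_left (Finset.single_le_sum (f := fun i => ‖b.repr ω i‖)
    (fun i _ => norm_nonneg _) (Finset.mem_univ i)) (norm_nonneg t)

/-- An element of `U(Λ)` that fixes a point of complex hyperbolic space has finite order. -/
theorem exists_pow_eq_one [Module.Free (Order D) Λ] [Module.Finite (Order D) Λ] (hD : D < 0)
    {g : Λ ≃ₗ[Order D] Λ} (hg : g ∈ unitaryGroup h)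
    {ω : Complexified D Λ} (hω : (h.form ω ω).re < 0) {α : ℂ} (hα : complexify g ω = α • ω) :
    ∃ M, 0 < M ∧ g ^ M = 1 := by
  classical
  obtain ⟨b, hb⟩ := h.signature
  let e := Module.Free.chooseBasis (Order D) Λ
  let e' := e.baseChange ℂ
  have hbound : ∀ j i, ∃ B, ∀ m : ℕ, ‖algebraMap (Order D) ℂ (e.repr ((g ^ m) (e j)) i)‖ ≤ B := by
    intro j i
    obtain ⟨B, hB⟩ := exists_bound_orbit h hb hg hω hα (1 ⊗ₜ[Order D] e j)
    refine ⟨∑ k, B * ‖e'.repr (b k) i‖, fun m => ?_⟩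
    have h1 : algebraMap (Order D) ℂ (e.repr ((g ^ m) (e j)) i) =
        e'.repr (complexify (g ^ m) (1 ⊗ₜ[Order D] e j)) i := by
      rw [complexify_tmul, Module.Basis.baseChange_repr_tmul, Algebra.smul_def, mul_one]
    rw [h1, ← b.sum_repr (complexify (g ^ m) (1 ⊗ₜ[Order D] e j)), map_sum, Finsupp.finsetSum_apply]
    refine (norm_sum_le _ _).trans (Finset.sum_le_sum fun k _ => ?_)
    rw [map_smul, Finsupp.smul_apply, smul_eq_mul, norm_mul]
    exact mul_le_mul_of_nonneg_right (hB m k) (norm_nonneg _)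
  choose B hB using hbound
  let F : ℕ → (Module.Free.ChooseBasisIndex (Order D) Λ → Module.Free.ChooseBasisIndex (Order D) Λ →
    Order D) := fun m j i => e.repr ((g ^ m) (e j)) i
  -- The matrix entries of all powers of `g` are bounded elements of `𝒪`, so only finitely many
  -- matrices occur and two powers of `g` coincide.
  have hfin : (Set.range F).Finite := by
    refine (Set.Finite.pi' fun j => Set.Finite.pi' fun i =>
      finite_setOf_norm_le hD (B j i)).subset ?_
    rintro _ ⟨m, rfl⟩ j i
    exact hB j i m
  have hninj : ¬ Function.Injective F := fun hinj =>
    Set.infinite_range_of_injective hinj hfin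
  rw [Function.Injective] at hninj
  push Not at hninj
  obtain ⟨m, m', hF, hne⟩ := hninj
  have hgeq : g ^ m = g ^ m' := by
    refine LinearEquiv.toLinearMap_injective (e.ext fun j => ?_)
    exact e.repr.injective (Finsupp.ext fun i => congrFun (congrFun hF j) i)
  rcases lt_or_gt_of_ne hne with hlt | hlt
  · exact ⟨m' - m, by omega, by rw [pow_sub g hlt.le, hgeq, mul_inv_cancel]⟩
  · exact ⟨m - m', by omega, by rw [pow_sub g hlt.le, hgeq, mul_inv_cancel]⟩

end Form

end BallQuotient

/-! ### Reduction of the theorem to eigenvalue data -/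

theorem Multiset.exists_perm_of_map_univ_eq {ι β : Type*} [Fintype ι] {u v : ι → β}
    (h : Finset.univ.val.map u = Finset.univ.val.map v) : ∃ σ : Equiv.Perm ι, ∀ i, u i = v (σ i) := by
  classical
  have hcard : ∀ z, Fintype.card {i // u i = z} = Fintype.card {i // v i = z} := fun z => by
    have h1 := congrArg (Multiset.count z) h
    rw [Multiset.count_map, Multiset.count_map] at h1
    rw [Fintype.card_subtype, Fintype.card_subtype]
    simp only [eq_comm (a := z)] at h1
    exact h1
  let e := fun z => Fintype.equivOfCardEq (hcard z)
  exact ⟨(Equiv.sigmaFiberEquiv u).symm.trans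
    ((Equiv.sigmaCongrRight e).trans (Equiv.sigmaFiberEquiv v)),
    fun i => (e (u i) ⟨i, rfl⟩).2.symm⟩

namespace BallQuotient

variable {D : ℤ} {n : ℕ} {Λ : Type*} [AddCommGroup Λ] [Module (Order D) Λ]

/-- The eigenvalues of an integral multiple of an automorphism of `Λ` are the roots of a
polynomial over `ℚ(√D)`. -/
theorem exists_poly_aroots_eq [Module.Free (Order D) Λ] [Module.Finite (Order D) Λ]
    (b : Module.Basis (Fin (n + 1)) ℂ (Complexified D Λ)) {g : Λ ≃ₗ[Order D] Λ}
    {μ : Fin (n + 1) → ℂ} (hμ : ∀ i, complexify g (b i) = μ i • b i) (s : ℤ) (f : ℕ) :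
    ∃ Q : (QuadField D)[X], Q.Monic ∧
      Q.aroots ℂ = Finset.univ.val.map fun i => (s : ℂ) * μ i ^ f := by
  set T : Λ →ₗ[Order D] Λ := (s : Order D) • (g ^ f).toLinearMap with hT
  refine ⟨T.charpoly.map (algebraMap (Order D) (QuadField D)), T.charpoly_monic.map _, ?_⟩
  have h1 : ∀ i, T.baseChange ℂ (b i) = ((s : ℂ) * μ i ^ f) • b i := by
    intro i
    rw [hT, LinearMap.baseChange_smul, LinearMap.smul_apply, mul_smul,
      ← complexify_pow_apply_of_eigen g (hμ i) f]
    change (s : Order D) • complexify (g ^ f) (b i) = _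
    rw [← algebraMap_smul ℂ (s : Order D), map_intCast]
  rw [aroots, Polynomial.map_map, ← IsScalarTower.algebraMap_eq (Order D) (QuadField D) ℂ,
    ← LinearMap.charpoly_baseChange, LinearMap.roots_charpoly_of_eigenbasis h1]

end BallQuotient

theorem mainTheorem5 (D : ℤ) (hD : Squarefree D) (hD3 : D < -3) (n : ℕ) (hn : 12 ≤ n)
    {Λ : Type*} [AddCommGroup Λ] [Module (BallQuotient.Order D) Λ]
    [Module.Free (BallQuotient.Order D) Λ] [Module.Finite (BallQuotient.Order D) Λ]
    (h : BallQuotient.HermitianStructure D n Λ)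
    (Γ : Subgroup (BallQuotient.unitaryGroup h)) (hΓ : Γ.FiniteIndex)
    (p : ℙ ℂ (BallQuotient.Complexified D Λ)) (hp : p ∈ BallQuotient.hyperbolicSpace h)
    (g : BallQuotient.pointStabilizer Γ p) (k : ℕ) (hk : 1 < k)
    (hqr : BallQuotient.IsQuasiReflection (BallQuotient.tangentAction (g ^ k)))
    (hmin : ∀ i : ℕ, 0 < i → i < k →
      ¬ BallQuotient.IsQuasiReflection (BallQuotient.tangentAction (g ^ i)))
    (l : ℕ) (hl : l = orderOf (BallQuotient.tangentAction (g ^ k)))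
    (ζ : ℂ) (hζ : IsPrimitiveRoot ζ (l * k)) :
    (∃ (a : Fin n → ℕ) (j : Fin n),
      BallQuotient.IsExponentSystem (BallQuotient.tangentAction g) l k ζ a j) ∧
    ∀ (a : Fin n → ℕ) (j : Fin n),
      BallQuotient.IsExponentSystem (BallQuotient.tangentAction g) l k ζ a j →
      ∀ f : ℕ, 1 ≤ f → f < k → 1 ≤ BallQuotient.sigmaPrime l k a j f := by
  have hK := BallQuotient.isGenericImaginary_quadField hD hD3
  have hD0 : D < 0 := by omega
  set G : Λ ≃ₗ[BallQuotient.Order D] Λ := ((g : BallQuotient.unitaryGroup h) :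
    Λ ≃ₗ[BallQuotient.Order D] Λ) with hG
  have hGU : G ∈ BallQuotient.unitaryGroup h := (g : BallQuotient.unitaryGroup h).2
  obtain ⟨α, hα⟩ : ∃ α : ℂ, BallQuotient.complexify G p.rep = α • p.rep := by
    have h1 : BallQuotient.complexify G p.rep ∈ p.submodule := by
      rw [← g.2.2]
      exact Submodule.mem_map_of_mem
        (by rw [Projectivization.submodule_eq]; exact Submodule.mem_span_singleton_self _)
    rw [Projectivization.submodule_eq] at h1
    obtain ⟨α, hα⟩ := Submodule.mem_span_singleton.1 h1
    exact ⟨α, hα.symm⟩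
  obtain ⟨M, hM, hGM⟩ := BallQuotient.exists_pow_eq_one h hD0 hGU hp hα
  obtain ⟨b₀, -⟩ := h.signature
  have hfinite : Module.Finite ℂ (BallQuotient.Complexified D Λ) := Module.Finite.of_basis b₀
  obtain ⟨b, μ, hbω, hμ⟩ := Module.End.exists_eigenbasis_of_pow_eq_one
    (T := (BallQuotient.complexify G).toLinearMap) hM
    (by rw [BallQuotient.complexify_pow, hGM]; exact LinearMap.ext BallQuotient.complexify_one)
    (n := n) (by rw [Module.finrank_eq_card_basis b₀, Fintype.card_fin]) p.rep_nonzero hα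
  have hμ' : ∀ i, BallQuotient.complexify G (b i) = μ i • b i := hμ
  have hμM : ∀ i, μ i ^ M = 1 := fun i => by
    have h1 := BallQuotient.complexify_pow_apply_of_eigen G (hμ' i) M
    rw [hGM, BallQuotient.complexify_one] at h1
    have h2 : (μ i ^ M - 1) • b i = 0 := by rw [sub_smul, one_smul, ← h1, sub_self]
    exact sub_eq_zero.1 ((smul_eq_zero.1 h2).resolve_right (b.ne_zero i))
  have hμ0 : ∀ i, μ i ≠ 0 := fun i h0 => by
    have := hμM i
    simp [h0, hM.ne'] at this
  obtain ⟨φ, hφ⟩ := BallQuotient.exists_tangent_eigenbasis b hbω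
  have hact : ∀ (m : ℕ) (i : Fin n), BallQuotient.tangentAction (g ^ m) (φ i) =
      (μ i.succ / μ 0) ^ m • φ i := fun m i => by
    rw [div_pow]
    refine hφ (g ^ m) (fun i => μ i ^ m) (fun i => pow_ne_zero m (hμ0 i)) (fun i => ?_) i
    have h1 : (((g ^ m : BallQuotient.pointStabilizer Γ p) : BallQuotient.unitaryGroup h) :
        Λ ≃ₗ[BallQuotient.Order D] Λ) = G ^ m := by push_cast; rfl
    rw [h1]
    exact BallQuotient.complexify_pow_apply_of_eigen G (hμ' i) m
  have hact1 : ∀ i, BallQuotient.tangentAction g (φ i) = (μ i.succ / μ 0) • φ i := fun i => by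
    have := hact 1 i
    rwa [pow_one, pow_one] at this
  have hroots : (BallQuotient.tangentAction g).toLinearMap.charpoly.roots =
      Finset.univ.val.map fun i : Fin n => μ i.succ / μ 0 :=
    LinearMap.roots_charpoly_of_eigenbasis hact1
  have hcM : ∀ i : Fin n, (μ i.succ / μ 0) ^ M = 1 := fun i => by
    rw [div_pow, hμM, hμM, div_one]
  have hl0 : 0 < l := by
    rw [hl, orderOf_pos_iff, isOfFinOrder_iff_pow_eq_one]
    refine ⟨M, hM, (LinearEquiv.pow_eq_one_iff_of_eigenbasis (hact k) M).2 fun i => ?_⟩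
    rw [← pow_mul, mul_comm, pow_mul, hcM, one_pow]
  have hcl : ∀ i : Fin n, (μ i.succ / μ 0) ^ (l * k) = 1 := fun i => by
    rw [mul_comm, pow_mul]
    exact (LinearEquiv.pow_eq_one_iff_of_eigenbasis (hact k) l).1
      (by rw [hl]; exact pow_orderOf_eq_one _) i
  constructor
  · have : NeZero (l * k) := ⟨by positivity⟩
    choose a ha hac using fun i => hζ.eq_pow_of_pow_eq_one (hcl i)
    obtain ⟨j, hj, -⟩ := (BallQuotient.isQuasiReflection_iff_of_eigenbasis (hact k)).1 hqr
    exact ⟨a, j, ha, by simp only [hroots, hac], by rw [hac]; exact hj⟩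
  · intro a j ha f hf hfk
    -- The given exponents list the same eigenvalues in some order; reindexing the eigenbasis by `σ`
    -- makes `ζ ^ a i` the eigenvalue on the `i`-th vector. The index of the quasi-reflection is
    -- then forced to be `j`.
    obtain ⟨σ, hσ⟩ := Multiset.exists_perm_of_map_univ_eq (ha.eigenvalues.symm.trans hroots)
    have hact' : ∀ (m : ℕ) (i : Fin n), BallQuotient.tangentAction (g ^ m) (φ.reindex σ.symm i) =
        (ζ ^ a i) ^ m • φ.reindex σ.symm i := fun m i => by
      rw [Module.Basis.reindex_apply, Equiv.symm_symm, hact, hσ]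
    obtain ⟨j', hj', hj'k⟩ := (BallQuotient.isQuasiReflection_iff_of_eigenbasis (hact' k)).1 hqr
    have hjj : j' = j := by
      by_contra hne
      exact ha.exceptional (hj'k j (Ne.symm hne))
    subst hjj
    have hdata : IsGenericImaginary.EigenvalueData (BallQuotient.QuadField D) (μ 0)
        (fun i => ζ ^ a i) k j' :=
      { finite_order := ⟨M, hM, hμM 0, fun i => by rw [hσ]; exact hcM (σ i)⟩
        poly := fun s f => by
          obtain ⟨Q, hQm, hQ⟩ := BallQuotient.exists_poly_aroots_eq b hμ' s f
          refine ⟨Q, hQm, ?_⟩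
          have h1 : (fun i => (s : ℂ) * (μ 0 * ζ ^ a i) ^ f) =
              (fun i : Fin n => (s : ℂ) * μ i.succ ^ f) ∘ σ := by
            funext i
            rw [hσ, mul_div_cancel₀ _ (hμ0 0), Function.comp_apply]
          rw [hQ, IsGenericImaginary.eigenvalueMultiset, h1, ← Multiset.map_map,
            Fin.univ_succ, Finset.cons_val, Multiset.map_cons, Finset.map_val, Multiset.map_map]
          congr 2
          have h2 := congrArg Finset.val (Finset.map_univ_equiv σ)
          rw [Finset.map_val] at h2
          exact h2.symm
        pow_ne := hj'
        pow_eq := hj'k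
        minimal := fun e he hek hje => by
          by_contra! hall
          exact hmin e he hek
            ((BallQuotient.isQuasiReflection_iff_of_eigenbasis (hact' e)).2 ⟨j', hje, hall⟩) }
    have hneg := hdata.pow_eq_neg_one hK (by omega)
    have hl2 : l = 2 := by
      rw [hl]
      refine orderOf_eq_prime ?_ fun h1 => ?_
      · refine (LinearEquiv.pow_eq_one_iff_of_eigenbasis (hact' k) 2).2 fun i => ?_
        by_cases hij : i = j'
        · rw [hij, hneg]; norm_num
        · rw [hj'k i hij, one_pow]
      · have h2 := (LinearEquiv.pow_eq_one_iff_of_eigenbasis (hact' k) 1).1 (by rw [h1, one_pow]) j'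
        rw [pow_one] at h2
        exact hj' h2
    rw [hl2] at hζ ⊢
    have hN : 0 < 2 * k := by omega
    have key := hdata.one_le_sum_rootAngle hK hn (by omega) hζ hf hfk
    rw [BallQuotient.sigmaPrime]
    refine key.trans_eq ?_
    congr 1
    -- Since `l = 2`, the term `{f * a j / k}` is the angle of `c j ^ (2 * f)` with respect to the
    -- denominator `2 * k`.
    · rw [← pow_mul, hζ.rootAngle_pow hN]
      congr 1
      push_cast
      have : (k : ℚ) ≠ 0 := by
        have : k ≠ 0 := by omega
        exact_mod_cast this
      field_simp
    · refine Finset.sum_congr rfl fun i _ => ?_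
      rw [← pow_mul, hζ.rootAngle_pow hN, mul_comm (a i)]
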